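/- Let $\gamma$ be the standard Gaussian measure on $\mathbb{R}^n$ and let $\lambda>0$. Let $\mathcal{P}(\lambda)$ be the class of Borel probability measures $\nu$ on $\mathbb{R}^n$ such that $\lambda\int g^2\,d\nu\le\int|\nabla g|^2\,d\nu$ for every smooth $\nu$-integrable $g:\mathbb{R}^n\to\mathbb{R}$ with $\int g\,d\nu=0$ (both integrals taken in $[0,\infty]$). For $d\nu=f\,d\gamma$, where $f\ge 0$ is weakly differentiable ($f\in W^{1,1}_{\mathrm{loc}}(\mathbb{R}^n)$), put $$\mathrm{H}(\nu)=\int f\log f\,d\gamma,\qquad \mathrm{I}(\nu)=\int\frac{|\nabla f|^2}{f}\,d\gamma,\qquad \delta_{\mathrm{LSI}}(\nu)=\tfrac12\,\mathrm{I}(\nu)-\mathrm{H}(\nu),$$ with $0\log 0=0$ and $\frac{|\nabla f|^2}{f}=0$ where $f=0$, and let $\nabla(\log f)=\nabla f/f$, which is defined $\nu$-almost everywhere. Put $$c_1(\lambda)=\tfrac12\bigl(1-c(\lambda)\bigr),\qquad c(\lambda)=\frac{1-\lambda+\lambda\log\lambda}{(1-\lambda)^2}\ \ (\lambda\ne1),\qquad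 c(1)=\tfrac12 .$$ Corollary. Let $d\nu=f\,d\gamma$ be a probability measure in $\mathcal{P}(\lambda)$, with $f\geq 0$ weakly differentiable and $\mathrm{H}(\nu)$ and $\mathrm{I}(\nu)$ well defined and finite. Then $\nu$ has a finite first moment, hence a barycenter $b=\int x\,d\nu(x)$, the integral $\int|\nabla(\log f)-b|^2\,d\nu$ is finite, and $$\delta_{\mathrm{LSI}}(\nu)\ \ge\ c_1(\lambda)\int_{\mathbb{R}^n}\bigl|\nabla(\log f)-b\bigr|^2\,d\nu .$$ -/

import Mathlib

open MeasureTheory ProbabilityTheory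
open scoped ContDiff ENNReal

/-- `G` is a weak gradient (with respect to Lebesgue measure) of `f : ℝⁿ → ℝ`. -/
def HasWeakGradient {n : ℕ} (f : EuclideanSpace ℝ (Fin n) → ℝ)
    (G : EuclideanSpace ℝ (Fin n) → EuclideanSpace ℝ (Fin n)) : Prop :=
  LocallyIntegrable f volume ∧ LocallyIntegrable G volume ∧
    ∀ φ : EuclideanSpace ℝ (Fin n) → ℝ, ContDiff ℝ ∞ φ → HasCompactSupport φ →
      ∀ v : EuclideanSpace ℝ (Fin n),
        ∫ x, f x * fderiv ℝ φ x v = -∫ x, inner ℝ (G x) v * φ x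

/-- `f` belongs to the local Sobolev space `W^{1,1}_loc(ℝⁿ)`. -/
def WeaklyDifferentiable {n : ℕ} (f : EuclideanSpace ℝ (Fin n) → ℝ) : Prop :=
  ∃ G, HasWeakGradient f G

open Classical in
/-- The weak gradient `∇f` of a weakly differentiable function. It is unique up to equality
almost everywhere; this is some representative of it. -/
noncomputable def weakGradient {n : ℕ} (f : EuclideanSpace ℝ (Fin n) → ℝ) :
    EuclideanSpace ℝ (Fin n) → EuclideanSpace ℝ (Fin n) :=
  if h : WeaklyDifferentiable f then h.choose else 0

/-- `∇(log f) = ∇f / f`. This is meaningful on `{f > 0}`, a set of full measure for the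
probability measure with density `f`. -/
noncomputable def gradientLog {n : ℕ} (f : EuclideanSpace ℝ (Fin n) → ℝ) :
    EuclideanSpace ℝ (Fin n) → EuclideanSpace ℝ (Fin n) :=
  fun x => (f x)⁻¹ • weakGradient f x

/-- The integrand `|∇f|² / f` of the Fisher information. Where `f = 0`, a nonnegative weakly
differentiable `f` has `∇f = 0` almost everywhere, and the quotient is read as `0`. -/
noncomputable def fisherIntegrand {n : ℕ} (f : EuclideanSpace ℝ (Fin n) → ℝ) :
    EuclideanSpace ℝ (Fin n) → ℝ :=
  fun x => ‖weakGradient f x‖ ^ 2 / f x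

/-- The Fisher information `I(ν) = ∫ |∇f|² / f dγ` of `dν = f dγ`. -/
noncomputable def fisherInformation {n : ℕ} (f : EuclideanSpace ℝ (Fin n) → ℝ) : ℝ :=
  ∫ x, fisherIntegrand f x ∂(stdGaussian (EuclideanSpace ℝ (Fin n)))

/-- The relative entropy `H(ν) = ∫ f log f dγ` of `dν = f dγ`. -/
noncomputable def relativeEntropy {n : ℕ} (f : EuclideanSpace ℝ (Fin n) → ℝ) : ℝ :=
  ∫ x, f x * Real.log (f x) ∂(stdGaussian (EuclideanSpace ℝ (Fin n)))

/-- The logarithmic Sobolev deficit `δ_LSI(ν) = I(ν) / 2 - H(ν)` of `dν = f dγ`. -/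
noncomputable def deficitLSI {n : ℕ} (f : EuclideanSpace ℝ (Fin n) → ℝ) : ℝ :=
  (1 / 2) * fisherInformation f - relativeEntropy f

/-- The class `P(lam)` of Borel probability measures on `ℝⁿ` satisfying the Poincaré inequality
`lam ∫ g² dν ≤ ∫ |∇g|² dν` for every smooth `g` with `∫ g dν = 0`; both sides are
integrals of nonnegative functions, with values in `[0, ∞]`. -/
def poincareClass (n : ℕ) (lam : ℝ) : Set (Measure (EuclideanSpace ℝ (Fin n))) :=
  {ν | IsProbabilityMeasure ν ∧
    ∀ g : EuclideanSpace ℝ (Fin n) → ℝ, ContDiff ℝ ∞ g → Integrable g ν → ∫ x, g x ∂ν = 0 →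
      ENNReal.ofReal lam * ∫⁻ x, ENNReal.ofReal (g x ^ 2) ∂ν
        ≤ ∫⁻ x, ENNReal.ofReal (‖gradient g x‖ ^ 2) ∂ν}

/-- `c(lam) = (1 - lam + lam log lam) / (1 - lam)²`, with `c(1) = 1 / 2`. -/
noncomputable def lsiConst (lam : ℝ) : ℝ :=
  if lam = 1 then 1 / 2 else (1 - lam + lam * Real.log lam) / (1 - lam) ^ 2

/-- `c₁(lam) = (1 - c(lam)) / 2`. -/
noncomputable def lsiConstOne (lam : ℝ) : ℝ :=
  (1 / 2) * (1 - lsiConst lam)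

open Filter Topology

/-! Write S = ∇ log f and A = ∫ |S − b|² dν. Gaussian integration by parts against constants gives ∫
S dν = b, so I(ν) = A + |b|², and the claim is equivalent to the entropy bound H(ν) ≤ ½ (|b|² + c(λ)
A).

By duality it suffices to bound ∫ g dν − log ∫ e^g dγ for bounded g (`integral_mul_log_le_of_dual`).
Put F = e^g, let X ~ ν and Z ~ γ be independent, t = sin² α, and Y_t = tX + √(t(1−t)) Z, the time-t
marginal of a Brownian bridge from 0 to X. With P_{1−t}F the Gaussian average of F at variance 1 −
t, the quantity E log P_{1−t}F(Y_t) runs from log ∫ F dγ at t = 0 to ∫ log F dν at t = 1. Stein's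
identity in Z and the score identity in X show that its t-derivative is E[w · S(X)] − ½ E|w|², where
w = ∇ log P_{1−t}F(Y_t) (`integral_avgVel_div`).

The Poincaré inequality limits how much a function of Y_t can correlate with a function of X: the
variance of E[h(Y_t) | X] is at most θ_t Var h(Y_t), with θ_t = t / (t + λ(1−t)) (from
`variance_gaussAvg_le`). Hence the derivative is at most ½ (|b|² + θ_t A) (`score_pairing_le`), and
∫₀¹ θ_t dt = c(λ) (`exists_primitive_lsiConst`).

Two regularity facts support this. The first moment is finite because truncated coordinates have
variance at most 1/λ. The identity f ∇ log f = ∇f holds almost everywhere because ∇f = 0 almost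
everywhere on {f = 0}, which is proved by translating subsets of that zero set. -/

abbrev Euc (n : ℕ) := EuclideanSpace ℝ (Fin n)

noncomputable abbrev gaussN (n : ℕ) : Measure (Euc n) := stdGaussian (EuclideanSpace ℝ (Fin n))

section

variable {n : ℕ}

/-! ### The density of the standard Gaussian measure -/

/-- The density of the standard Gaussian measure with respect to Lebesgue measure. -/
noncomputable def gaussDensity (x : Euc n) : ℝ :=
  (∫ v : Euc n, Real.exp (-(1 / 2) * ‖v‖ ^ 2))⁻¹ * Real.exp (-(1 / 2) * ‖x‖ ^ 2)

lemma integral_exp_neg_half_sq_pos : 0 < ∫ v : Euc n, Real.exp (-(1 / 2) * ‖v‖ ^ 2) := by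
  rw [GaussianFourier.integral_rexp_neg_mul_sq_norm (by norm_num : (0 : ℝ) < 1 / 2)]
  positivity

lemma gaussDensity_pos (x : Euc n) : 0 < gaussDensity x :=
  mul_pos (inv_pos.2 integral_exp_neg_half_sq_pos) (Real.exp_pos _)

lemma contDiff_gaussDensity : ContDiff ℝ ∞ (gaussDensity (n := n)) := by
  unfold gaussDensity
  exact contDiff_const.mul ((contDiff_const.mul (contDiff_norm_sq ℝ)).exp)

lemma measurable_gaussDensity : Measurable (gaussDensity (n := n)) :=
  contDiff_gaussDensity.continuous.measurable

lemma fderiv_gaussDensity (x v : Euc n) :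
    fderiv ℝ gaussDensity x v = -inner ℝ x v * gaussDensity x := by
  have h : HasFDerivAt (gaussDensity (n := n))
      ((∫ v : Euc n, Real.exp (-(1 / 2) * ‖v‖ ^ 2))⁻¹ • (Real.exp (-(1 / 2) * ‖x‖ ^ 2) •
        ((-(1 / 2) : ℝ) • (2 • (innerSL ℝ x))))) x :=
    ((((hasStrictFDerivAt_norm_sq x).hasFDerivAt).const_mul _).exp).const_mul _
  rw [h.fderiv]
  simp [gaussDensity]
  ring

lemma integrable_exp_neg_half_sq : Integrable fun v : Euc n => Real.exp (-(1 / 2) * ‖v‖ ^ 2) :=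
  -- The Bochner integral of a non-integrable function is 0, so a positive value certifies
  -- integrability.
  Integrable.of_integral_ne_zero integral_exp_neg_half_sq_pos.ne'

lemma isProbabilityMeasure_gaussDensity : IsProbabilityMeasure
    ((volume : Measure (Euc n)).withDensity fun x => ENNReal.ofReal (gaussDensity x)) := by
  constructor
  rw [withDensity_apply _ MeasurableSet.univ, Measure.restrict_univ,
    ← ofReal_integral_eq_lintegral_ofReal]
  · unfold gaussDensity
    rw [integral_const_mul, inv_mul_cancel₀ integral_exp_neg_half_sq_pos.ne', ENNReal.ofReal_one]
  · exact integrable_exp_neg_half_sq.const_mul _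
  · exact .of_forall fun x => (gaussDensity_pos x).le

lemma stdGaussian_eq_withDensity : gaussN n =
    (volume : Measure (Euc n)).withDensity fun x => ENNReal.ofReal (gaussDensity x) := by
  have := isProbabilityMeasure_gaussDensity (n := n)
  apply Measure.ext_of_charFun
  ext t
  rw [charFun_stdGaussian, charFun_apply, integral_withDensity_eq_integral_toReal_smul
    measurable_gaussDensity.ennreal_ofReal (by simp)]
  have hb : (0 : ℝ) < ((1 / 2 : ℝ) : ℂ).re := by simp
  have h1 := GaussianFourier.integral_cexp_neg_mul_sq_norm_add hb Complex.I t
  have h0 := GaussianFourier.integral_rexp_neg_mul_sq_norm (V := Euc n)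
    (by norm_num : (0 : ℝ) < 1 / 2)
  have h2 : ∀ x : Euc n, (ENNReal.ofReal (gaussDensity x)).toReal •
      Complex.exp ((inner ℝ x t : ℝ) * Complex.I) =
      ((∫ v : Euc n, Real.exp (-(1 / 2) * ‖v‖ ^ 2) : ℝ) : ℂ)⁻¹ *
      Complex.exp (-((1 / 2 : ℝ) : ℂ) * ‖x‖ ^ 2 + Complex.I * (inner ℝ t x : ℝ)) := by
    intro x
    rw [ENNReal.toReal_ofReal (gaussDensity_pos x).le, Complex.exp_add, real_inner_comm,
      gaussDensity]
    simp only [Complex.real_smul]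
    push_cast
    ring_nf
  simp_rw [h2]
  rw [integral_const_mul, h1, h0, ← mul_assoc]
  have h3 : (((Real.pi / (1 / 2)) ^ ((Module.finrank ℝ (Euc n) : ℝ) / 2) : ℝ) : ℂ) =
      ((Real.pi : ℂ) / ((1 / 2 : ℝ) : ℂ)) ^ ((Module.finrank ℝ (Euc n) : ℂ) / 2) := by
    rw [Complex.ofReal_cpow (by positivity)]
    push_cast
    rfl
  rw [h3, inv_mul_cancel₀, one_mul]
  · congr 1
    rw [Complex.I_sq]
    push_cast
    ring
  · rw [← h3]
    exact_mod_cast (by positivity : (0 : ℝ) <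
      (Real.pi / (1 / 2)) ^ ((Module.finrank ℝ (Euc n) : ℝ) / 2)).ne'

lemma integral_gaussN (g : Euc n → ℝ) :
    ∫ x, g x ∂(gaussN n) = ∫ x, gaussDensity x * g x := by
  rw [stdGaussian_eq_withDensity, integral_withDensity_eq_integral_toReal_smul
    measurable_gaussDensity.ennreal_ofReal (by simp)]
  simp [ENNReal.toReal_ofReal (gaussDensity_pos _).le]

lemma gaussN_ae_iff {p : Euc n → Prop} :
    (∀ᵐ x ∂(gaussN n), p x) ↔ ∀ᵐ x, p x := by
  rw [stdGaussian_eq_withDensity, ae_withDensity_iff measurable_gaussDensity.ennreal_ofReal]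
  simp [gaussDensity_pos]

lemma integrable_norm_gaussN : Integrable (fun x : Euc n => ‖x‖) (gaussN n) :=
  (IsGaussian.integrable_id (μ := gaussN n)).norm

/-! ### Approximation by smooth compactly supported functions -/

/-- Density of test functions in L¹ alone would lose the uniform bound. Approximating arcsin(g / M)
instead and then applying M sin restores it; smoothness survives, and so does compact support
because sin 0 = 0. -/
lemma exists_contDiff_seq_tendsto_ae (μ : Measure (Euc n)) [IsFiniteMeasure μ]
    {g : Euc n → ℝ} (hg : AEStronglyMeasurable g μ) {M : ℝ} (hM : 0 < M) (hb : ∀ x, |g x| ≤ M) :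
    ∃ h : ℕ → Euc n → ℝ, (∀ k, ContDiff ℝ ∞ (h k)) ∧ (∀ k, HasCompactSupport (h k)) ∧
      (∀ k x, |h k x| ≤ M) ∧ ∀ᵐ x ∂μ, Tendsto (fun k => h k x) atTop (𝓝 (g x)) := by
  set G : Euc n → ℝ := fun x => Real.arcsin (g x / M) with hG
  have hGm : AEStronglyMeasurable G μ :=
    Real.continuous_arcsin.comp_aestronglyMeasurable
      (by simpa only [div_eq_mul_inv] using hg.mul_const M⁻¹)
  have hGL : MemLp G 1 μ := by
    refine MemLp.of_bound hGm (Real.pi / 2) (.of_forall fun x => ?_)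
    rw [Real.norm_eq_abs, abs_le]
    exact ⟨Real.neg_pi_div_two_le_arcsin _, Real.arcsin_le_pi_div_two _⟩
  have hk : ∀ k : ℕ, ∃ φ : Euc n → ℝ, HasCompactSupport φ ∧ ContDiff ℝ ∞ φ ∧
      eLpNorm (G - φ) 1 μ ≤ ENNReal.ofReal (1 / ((k : ℝ) + 1)) := fun k =>
    hGL.exist_eLpNorm_sub_le (by simp) le_rfl (by positivity)
  choose φ hφ1 hφ2 hφ3 using hk
  have hlim : Tendsto (fun k => eLpNorm (φ k - G) 1 μ) atTop (𝓝 0) := by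
    have h0 : Tendsto (fun k : ℕ => ENNReal.ofReal (1 / ((k : ℝ) + 1))) atTop (𝓝 0) := by
      have := (ENNReal.continuous_ofReal.tendsto 0).comp
        (tendsto_one_div_add_atTop_nhds_zero_nat (𝕜 := ℝ))
      simpa [Function.comp_def] using this
    refine tendsto_of_tendsto_of_tendsto_of_le_of_le tendsto_const_nhds h0 (fun _ => zero_le) ?_
    intro k
    simp only
    rw [eLpNorm_sub_comm]
    exact hφ3 k
  obtain ⟨ns, -, hns⟩ := (tendstoInMeasure_of_tendsto_eLpNorm one_ne_zero
    (fun k => (hφ2 k).continuous.aestronglyMeasurable) hGm hlim).exists_seq_tendsto_ae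
  refine ⟨fun k x => M * Real.sin (φ (ns k) x), fun k => contDiff_const.mul (hφ2 _).sin,
    fun k => ?_, fun k x => ?_, ?_⟩
  · exact ((hφ1 (ns k)).comp_left (g := fun y => M * Real.sin y) (by simp))
  · rw [abs_mul, abs_of_pos hM]
    exact mul_le_of_le_one_right hM.le (Real.abs_sin_le_one _)
  · filter_upwards [hns] with x hx
    have h1 := ((Real.continuous_sin.tendsto _).comp hx).const_mul M
    have h2 := abs_le.1 (hb x)
    have h3 : M * Real.sin (G x) = g x := by
      rw [hG, Real.sin_arcsin]
      · field_simp
      · rw [le_div_iff₀ hM]; linarith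
      · rw [div_le_iff₀ hM]; linarith
    rw [h3] at h1
    exact h1

/-- A sequence of smooth cutoff functions tending to `1`, with uniformly bounded gradients. -/
lemma exists_cutoff_seq (n : ℕ) : ∃ (χ : ℕ → Euc n → ℝ) (C : ℝ), (∀ k, ContDiff ℝ ∞ (χ k)) ∧
    (∀ k, HasCompactSupport (χ k)) ∧ (∀ k x, |χ k x| ≤ 1) ∧ (∀ k x, ‖fderiv ℝ (χ k) x‖ ≤ C) ∧
    (∀ x, Tendsto (fun k => χ k x) atTop (𝓝 1)) ∧
    ∀ x, Tendsto (fun k => fderiv ℝ (χ k) x) atTop (𝓝 0) := by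
  let b : ContDiffBump (0 : Euc n) := ⟨1, 2, one_pos, one_lt_two⟩
  obtain ⟨C, hC⟩ := (b.hasCompactSupport.fderiv ℝ).exists_bound_of_continuous
    (b.contDiff.continuous_fderiv (n := ∞) (by simp))
  have hC0 : 0 ≤ C := (norm_nonneg _).trans (hC 0)
  have hd : ∀ (k : ℕ) (x : Euc n), fderiv ℝ (fun x => b ((k + 1 : ℝ)⁻¹ • x)) x =
      (k + 1 : ℝ)⁻¹ • fderiv ℝ b ((k + 1 : ℝ)⁻¹ • x) := by
    intro k x
    exact fderiv_comp_smul _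
  have hi : Tendsto (fun k : ℕ => ((k : ℝ) + 1)⁻¹) atTop (𝓝 0) := by
    simpa using (tendsto_one_div_add_atTop_nhds_zero_nat (𝕜 := ℝ))
  refine ⟨fun k x => b ((k + 1 : ℝ)⁻¹ • x), C, fun k => b.contDiff.comp (by fun_prop),
    fun k => ?_, fun k x => ?_, fun k x => ?_, fun x => ?_, fun x => ?_⟩
  · exact b.hasCompactSupport.comp_smul (by positivity)
  · rw [abs_of_nonneg b.nonneg]
    exact b.le_one
  · rw [hd, norm_smul]
    have h1 : ‖((k : ℝ) + 1)⁻¹‖ ≤ 1 := by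
      rw [Real.norm_of_nonneg (by positivity)]
      exact inv_le_one_of_one_le₀ (by linarith [(Nat.cast_nonneg k : (0 : ℝ) ≤ k)])
    calc _ ≤ 1 * C := mul_le_mul h1 (hC _) (norm_nonneg _) zero_le_one
      _ = C := one_mul C
  · have h1 : Tendsto (fun k : ℕ => b (((k : ℝ) + 1)⁻¹ • x)) atTop (𝓝 (b ((0 : ℝ) • x))) :=
      (b.continuous.tendsto _).comp (hi.smul_const x)
    rwa [zero_smul, b.one_of_mem_closedBall (by simp [b])] at h1
  · simp_rw [hd]
    refine squeeze_zero_norm (a := fun k : ℕ => ((k : ℝ) + 1)⁻¹ * C) (fun k => ?_) ?_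
    · rw [norm_smul, Real.norm_of_nonneg (by positivity)]
      exact mul_le_mul_of_nonneg_left (hC _) (by positivity)
    · simpa using hi.mul_const C

/-! ### Gaussian integration by parts -/

/-- The weak gradient is tested against h times the Gaussian density; differentiating the density
produces the term with ⟨x, v⟩. -/
lemma HasWeakGradient.gaussian_ibp_of_hasCompactSupport {f : Euc n → ℝ} {G : Euc n → Euc n}
    (hw : HasWeakGradient f G) {h : Euc n → ℝ} (hh : ContDiff ℝ ∞ h) (hc : HasCompactSupport h)
    (v : Euc n) :
    ∫ x, f x * (fderiv ℝ h x v - inner ℝ x v * h x) ∂(gaussN n) =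
      -∫ x, inner ℝ (G x) v * h x ∂(gaussN n) := by
  have h1 := hw.2.2 (fun x => h x * gaussDensity x) (hh.mul contDiff_gaussDensity)
    (hc.mul_right) v
  rw [integral_gaussN, integral_gaussN]
  convert h1 using 1
  · refine integral_congr_ae (.of_forall fun x => ?_)
    have hd : fderiv ℝ (fun x => h x * gaussDensity x) x =
        h x • fderiv ℝ gaussDensity x + gaussDensity x • fderiv ℝ h x :=
      fderiv_fun_mul ((hh.differentiable (by simp)) x)
        ((contDiff_gaussDensity.differentiable (by simp)) x)
    simp only [hd, add_apply, smul_apply,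
      fderiv_gaussDensity, smul_eq_mul]
    ring
  · congr 1
    refine integral_congr_ae (.of_forall fun x => ?_)
    ring

/-- Cutoffs remove the compact support of h. Integrability of ‖x‖ f dominates the drift term, and
the uniform bound on the cutoff gradients handles the extra one. -/
lemma HasWeakGradient.gaussian_ibp {f : Euc n → ℝ} {G : Euc n → Euc n}
    (hw : HasWeakGradient f G) (hf : Integrable f (gaussN n))
    (hxf : Integrable (fun x => ‖x‖ * f x) (gaussN n)) (hG : Integrable G (gaussN n))
    {h : Euc n → ℝ} (hh : ContDiff ℝ ∞ h) {C : ℝ} (hb : ∀ x, |h x| ≤ C)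
    (hb' : ∀ x, ‖fderiv ℝ h x‖ ≤ C) (v : Euc n) :
    ∫ x, f x * (fderiv ℝ h x v - inner ℝ x v * h x) ∂(gaussN n) =
      -∫ x, inner ℝ (G x) v * h x ∂(gaussN n) := by
  obtain ⟨χ, D, hχ1, hχ2, hχ3, hχ4, hχ5, hχ6⟩ := exists_cutoff_seq n
  have hC : 0 ≤ C := (abs_nonneg _).trans (hb 0)
  have hD : 0 ≤ D := (norm_nonneg _).trans (hχ4 0 0)
  have hfd : Continuous (fderiv ℝ h) := hh.continuous_fderiv (by simp)
  have key : ∀ k, ∫ x, f x * ((χ k x * fderiv ℝ h x v + h x * fderiv ℝ (χ k) x v)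
      - inner ℝ x v * (χ k x * h x)) ∂(gaussN n) =
      -∫ x, inner ℝ (G x) v * (χ k x * h x) ∂(gaussN n) := by
    intro k
    rw [← hw.gaussian_ibp_of_hasCompactSupport (h := fun x => χ k x * h x) ((hχ1 k).mul hh)
      (hχ2 k).mul_right v]
    refine integral_congr_ae (.of_forall fun x => ?_)
    have hd : fderiv ℝ (fun x => χ k x * h x) x = χ k x • fderiv ℝ h x + h x • fderiv ℝ (χ k) x :=
      fderiv_fun_mul ((hχ1 k).differentiable (by simp) x) (hh.differentiable (by simp) x)
    simp [hd]
  have hχm : ∀ k, Continuous (χ k) := fun k => (hχ1 k).continuous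
  have hχd : ∀ k, Continuous (fderiv ℝ (χ k)) := fun k => (hχ1 k).continuous_fderiv (by simp)
  have hhm : Continuous h := hh.continuous
  have t1 : Tendsto (fun k => ∫ x, f x * ((χ k x * fderiv ℝ h x v + h x * fderiv ℝ (χ k) x v)
      - inner ℝ x v * (χ k x * h x)) ∂(gaussN n)) atTop
      (𝓝 (∫ x, f x * (fderiv ℝ h x v - inner ℝ x v * h x) ∂(gaussN n))) := by
    refine tendsto_integral_of_dominated_convergence
      (fun x => (C * ‖v‖ + C * (D * ‖v‖)) * |f x| + ‖v‖ * C * |‖x‖ * f x|) (fun k => ?_)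
      ((hf.abs.const_mul _).add (hxf.abs.const_mul _)) (fun k => .of_forall fun x => ?_)
      (.of_forall fun x => ?_)
    · exact hf.1.mul (Continuous.aestronglyMeasurable (by fun_prop))
    · rw [Real.norm_eq_abs, abs_mul, abs_mul, abs_of_nonneg (norm_nonneg x)]
      have e1 : |χ k x * fderiv ℝ h x v| ≤ C * ‖v‖ := by
        rw [abs_mul]
        have := ((fderiv ℝ h x).le_opNorm v).trans
          (mul_le_mul_of_nonneg_right (hb' x) (norm_nonneg v))
        exact (mul_le_of_le_one_left (abs_nonneg _) (hχ3 k x)).trans this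
      have e2 : |h x * fderiv ℝ (χ k) x v| ≤ C * (D * ‖v‖) := by
        rw [abs_mul]
        have := ((fderiv ℝ (χ k) x).le_opNorm v).trans
          (mul_le_mul_of_nonneg_right (hχ4 k x) (norm_nonneg v))
        exact mul_le_mul (hb x) this (abs_nonneg _) hC
      have e3 : |inner ℝ x v * (χ k x * h x)| ≤ (‖x‖ * ‖v‖) * C := by
        rw [abs_mul]
        refine mul_le_mul (abs_real_inner_le_norm x v) ?_ (abs_nonneg _) (by positivity)
        rw [abs_mul]
        exact (mul_le_of_le_one_left (abs_nonneg _) (hχ3 k x)).trans (hb x)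
      have e4 : |χ k x * fderiv ℝ h x v + h x * fderiv ℝ (χ k) x v - inner ℝ x v * (χ k x * h x)| ≤
          C * ‖v‖ + C * (D * ‖v‖) + (‖x‖ * ‖v‖) * C :=
        (abs_sub _ _).trans (add_le_add ((abs_add_le _ _).trans (add_le_add e1 e2)) e3)
      calc _ ≤ |f x| * (C * ‖v‖ + C * (D * ‖v‖) + (‖x‖ * ‖v‖) * C) :=
            mul_le_mul_of_nonneg_left e4 (abs_nonneg _)
        _ = _ := by ring
    · have a1 := (hχ5 x).mul_const (fderiv ℝ h x v)
      have a2 : Tendsto (fun k => h x * fderiv ℝ (χ k) x v) atTop (𝓝 (h x * 0)) := by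
        refine Tendsto.const_mul _ ?_
        simpa [Function.comp_def] using ((ContinuousLinearMap.apply ℝ ℝ v).continuous.tendsto _).comp (hχ6 x)
      have a3 := ((hχ5 x).mul_const (h x)).const_mul (inner ℝ x v)
      simpa using ((a1.add a2).sub a3).const_mul (f x)
  have t2 : Tendsto (fun k => -∫ x, inner ℝ (G x) v * (χ k x * h x) ∂(gaussN n)) atTop
      (𝓝 (-∫ x, inner ℝ (G x) v * h x ∂(gaussN n))) := by
    refine (tendsto_integral_of_dominated_convergence
      (fun x => ‖v‖ * C * ‖G x‖) (fun k => ?_) (hG.norm.const_mul _)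
      (fun k => .of_forall fun x => ?_) (.of_forall fun x => ?_)).neg
    · exact (hG.1.inner_const).mul (Continuous.aestronglyMeasurable (by fun_prop))
    · rw [Real.norm_eq_abs, abs_mul, abs_mul]
      calc _ ≤ (‖G x‖ * ‖v‖) * (1 * C) :=
            mul_le_mul (abs_real_inner_le_norm _ _)
              (mul_le_mul (hχ3 k x) (hb x) (abs_nonneg _) zero_le_one) (by positivity)
              (by positivity)
        _ = _ := by ring
    · simpa using ((hχ5 x).mul_const (h x)).const_mul (inner ℝ (G x) v)
  simp_rw [key] at t1
  exact tendsto_nhds_unique t1 t2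

lemma hasWeakGradient_one : HasWeakGradient (fun _ : Euc n => (1 : ℝ)) 0 := by
  refine ⟨continuous_const.locallyIntegrable, continuous_const.locallyIntegrable,
    fun φ hφ hc v => ?_⟩
  have hφ' : Continuous (fderiv ℝ φ) := hφ.continuous_fderiv (by simp)
  have hi : Integrable (fun x => fderiv ℝ φ x v) (volume : Measure (Euc n)) :=
    Continuous.integrable_of_hasCompactSupport (by fun_prop) (hc.fderiv_apply (𝕜 := ℝ) v)
  have := integral_mul_fderiv_eq_neg_fderiv_mul_of_integrable (μ := (volume : Measure (Euc n)))
    (f := fun _ => (1 : ℝ)) (g := φ) (v := v) (by simp) (by simpa using hi)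
    (by simpa using hφ.continuous.integrable_of_hasCompactSupport hc)
    (fun x _ => by fun_prop) (fun x _ => hφ.differentiable (by simp) x)
  simpa using this

/-- Stein's identity for the standard Gaussian measure. -/
lemma stein_gaussN {h : Euc n → ℝ} (hh : ContDiff ℝ ∞ h) {C : ℝ} (hb : ∀ x, |h x| ≤ C)
    (hb' : ∀ x, ‖fderiv ℝ h x‖ ≤ C) (v : Euc n) :
    ∫ x, inner ℝ x v * h x ∂(gaussN n) = ∫ x, fderiv ℝ h x v ∂(gaussN n) := by
  have h1 := hasWeakGradient_one.gaussian_ibp (integrable_const _)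
    (by simpa using integrable_norm_gaussN (n := n)) (integrable_zero _ _ _) hh hb hb' v
  have hfd : Continuous (fderiv ℝ h) := hh.continuous_fderiv (by simp)
  have hc := hh.continuous
  simp only [one_mul, Pi.zero_apply, inner_zero_left, zero_mul, integral_zero, neg_zero] at h1
  rw [integral_sub, sub_eq_zero] at h1
  · exact h1.symm
  · refine Integrable.of_bound (Continuous.aestronglyMeasurable (by fun_prop)) (C * ‖v‖)
      (.of_forall fun x => ?_)
    exact ((fderiv ℝ h x).le_opNorm v).trans (mul_le_mul_of_nonneg_right (hb' x) (norm_nonneg v))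
  · refine (integrable_norm_gaussN.const_mul (‖v‖ * C)).mono'
      (Continuous.aestronglyMeasurable (by fun_prop)) (.of_forall fun x => ?_)
    rw [Real.norm_eq_abs, abs_mul]
    calc _ ≤ (‖x‖ * ‖v‖) * C :=
          mul_le_mul (abs_real_inner_le_norm _ _) (hb x) (abs_nonneg _) (by positivity)
      _ = _ := by ring

/-! ### The weak gradient of a nonnegative function vanishes on its zero set -/

/-- The integral is the convolution of f with the reflection of h, so the derivative falls on the
smooth factor; the weak gradient then moves it back to f. -/
lemma HasWeakGradient.hasDerivAt_integral_translate {f : Euc n → ℝ} {G : Euc n → Euc n}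
    (hw : HasWeakGradient f G) {h : Euc n → ℝ} (hh : ContDiff ℝ ∞ h) (hc : HasCompactSupport h)
    (v : Euc n) (s : ℝ) :
    HasDerivAt (fun s : ℝ => ∫ x, f x * h (x - s • v)) (∫ x, inner ℝ (G x) v * h (x - s • v)) s := by
  set h' : Euc n → ℝ := fun x => h (-x) with hh'
  have hn : HasCompactSupport h' := hc.comp_homeomorph (Homeomorph.neg (Euc n))
  have hs' : ContDiff ℝ ∞ h' := hh.comp contDiff_neg
  have h1 := hn.hasFDerivAt_convolution_right (μ := (volume : Measure (Euc n)))
    (ContinuousLinearMap.mul ℝ ℝ) hw.1 (hs'.of_le (by simp)) (s • v)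
  have h2 : HasDerivAt (fun s : ℝ => s • v) ((1 : ℝ) • v) s := (hasDerivAt_id s).smul_const v
  have h3 := h1.comp_hasDerivAt s h2
  have e1 : (convolution f h' (ContinuousLinearMap.mul ℝ ℝ) volume ∘ fun s : ℝ => s • v) =
      fun s : ℝ => ∫ x, f x * h (x - s • v) := by
    ext s
    simp [convolution, hh']
  have e2 : ((convolution f (fderiv ℝ h') ((ContinuousLinearMap.mul ℝ ℝ).precompR (Euc n)) volume)
      (s • v)) ((1 : ℝ) • v) = ∫ x, inner ℝ (G x) v * h (x - s • v) := by
    rw [one_smul, convolution_precompR_apply _ hw.1 (hn.fderiv ℝ)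
      (hs'.continuous_fderiv (by simp))]
    have h4 := hw.2.2 (fun x => h (x - s • v)) (hh.comp (by fun_prop))
      (hc.comp_homeomorph (Homeomorph.subRight (s • v))) v
    have h5 : ∀ x, fderiv ℝ (fun x => h (x - s • v)) x v = fderiv ℝ h (x - s • v) v := by
      intro x
      rw [fderiv_comp_sub]
    have h6 : ∀ x, fderiv ℝ h' x v = - fderiv ℝ h (-x) v := by
      intro x
      have := ((hh.differentiable (by simp) (-x)).hasFDerivAt.comp x
        (hasFDerivAt_id (𝕜 := ℝ) x).neg).fderiv
      simp only [Function.comp_def] at this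
      rw [hh', this]
      simp
    simp_rw [h5] at h4
    simp only [convolution, ContinuousLinearMap.mul_apply', h6, neg_sub, mul_neg, integral_neg, h4,
      neg_neg]
  rw [e1, e2] at h3
  exact h3

/-- A first-order expansion in t whose remainder depends on h only through its sup bound and
support, not its gradient. It therefore survives a limit in which h tends to an indicator function.
-/
lemma HasWeakGradient.exists_translate_bound {f : Euc n → ℝ} {G : Euc n → Euc n}
    (hw : HasWeakGradient f G) (v : Euc n) (R : ℝ) {η : ℝ} (hη : 0 < η) :
    ∃ C, ∀ h : Euc n → ℝ, ContDiff ℝ ∞ h → HasCompactSupport h → (∀ x, |h x| ≤ 1) →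
      (∀ x, x ∉ Metric.closedBall (0 : Euc n) R → h x = 0) → ∀ t ∈ Set.Icc (0 : ℝ) 1,
      |(∫ x, f x * h (x - t • v)) - (∫ x, f x * h x) - t * ∫ x, inner ℝ (G x) v * h x| ≤
        t * (2 * η + C * t) := by
  -- The enlarged ball contains the supports of all the translates of h with parameter in [0, 1].
  set B := Metric.closedBall (0 : Euc n) (R + ‖v‖) with hB
  set q : Euc n → ℝ := fun x => inner ℝ (G x) v with hq
  have hGB : IntegrableOn G B := hw.2.1.integrableOn_isCompact (isCompact_closedBall _ _)
  have hqB : IntegrableOn q B := hGB.inner_const v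
  have hqi : Integrable (B.indicator q) := hqB.integrable_indicator Metric.isClosed_closedBall.measurableSet
  obtain ⟨r, hr1, hr2, hr3⟩ := (memLp_one_iff_integrable.2 hqi).exist_eLpNorm_sub_le
    (by simp) le_rfl hη
  have hri : Integrable r := hr2.continuous.integrable_of_hasCompactSupport hr1
  have hr4 : ∫ x, |B.indicator q x - r x| ≤ η := by
    have h1 := hqi.sub hri
    have h2 : eLpNorm (B.indicator q - r) 1 volume = ENNReal.ofReal (∫ x, |B.indicator q x - r x|) := by
      rw [eLpNorm_one_eq_lintegral_enorm, ← ofReal_integral_norm_eq_lintegral_enorm h1]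
      rfl
    rw [h2] at hr3
    exact (ENNReal.ofReal_le_ofReal_iff hη.le).1 hr3
  obtain ⟨L, hL⟩ := (hr1.fderiv ℝ).exists_bound_of_continuous
    (hr2.continuous_fderiv (n := ∞) (by simp))
  have hL0 : 0 ≤ L := (norm_nonneg _).trans (hL 0)
  have hlip : ∀ x y, |r x - r y| ≤ L * ‖x - y‖ := fun x y =>
    convex_univ.norm_image_sub_le_of_norm_fderiv_le
      (fun z _ => hr2.differentiable (by simp) z) (fun z _ => hL z) (Set.mem_univ y) (Set.mem_univ x)
  set V := (volume (Metric.closedBall (0 : Euc n) R)).toReal with hV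
  refine ⟨L * ‖v‖ * V, fun h hh hc hb hs t ht => ?_⟩
  have hcont := hh.continuous
  have key : ∀ s ∈ Set.Icc (0 : ℝ) t,
      |(∫ x, q x * h (x - s • v)) - ∫ x, q x * h x| ≤ 2 * η + L * ‖v‖ * V * t := by
    intro s hst
    have hs1 : s ≤ 1 := hst.2.trans ht.2
    have hsv : ‖s • v‖ ≤ ‖v‖ := by
      rw [norm_smul, Real.norm_of_nonneg hst.1]
      exact mul_le_of_le_one_left (norm_nonneg _) hs1
    have hz1 : ∀ x, x ∉ B → h x = 0 := fun x hx => hs x fun hx' => hx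
      (Metric.closedBall_subset_closedBall (by linarith [norm_nonneg v]) hx')
    have hz2 : ∀ x, x ∉ B → h (x - s • v) = 0 := fun x hx => hs _ fun hx' => hx (by
      rw [hB, mem_closedBall_zero_iff]
      rw [mem_closedBall_zero_iff] at hx'
      calc ‖x‖ = ‖(x - s • v) + s • v‖ := by simp
        _ ≤ R + ‖v‖ := (norm_add_le _ _).trans (add_le_add hx' hsv))
    have hq1 : ∀ x, q x * h x = B.indicator q x * h x := fun x => by
      by_cases hx : x ∈ B
      · simp [hx]
      · simp [hz1 x hx]
    have hq2 : ∀ x, q x * h (x - s • v) = B.indicator q x * h (x - s • v) := fun x => by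
      by_cases hx : x ∈ B
      · simp [hx]
      · simp [hz2 x hx]
    have hbd : ∀ u : Euc n → ℝ, Integrable u → ∀ g : Euc n → ℝ, Continuous g → (∀ x, |g x| ≤ 1) →
        Integrable (fun x => u x * g x) := fun u hu g hg hg1 =>
      hu.mul_bdd (c := 1) hg.aestronglyMeasurable (.of_forall hg1)
    have hc2 : Continuous fun x => h (x - s • v) := by fun_prop
    have i1 := hbd _ hqi _ hcont hb
    have i2 := hbd _ hqi _ hc2 (fun x => hb _)
    have i3 := hbd _ hri _ hcont hb
    have i4 := hbd _ hri _ hc2 (fun x => hb _)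
    have i5 : Integrable (fun x => r (x + s • v) * h x) := by
      simpa using i4.comp_add_right (s • v)
    -- The L¹-small part q − r absorbs the difference of h, which is at most 2; for the Lipschitz
    -- part r the translation is moved from h onto r.
    have e1 : (∫ x, q x * h (x - s • v)) - ∫ x, q x * h x =
        (∫ x, (B.indicator q x - r x) * (h (x - s • v) - h x)) +
          ∫ x, (r (x + s • v) - r x) * h x := by
      have e2 : ∫ x, r (x + s • v) * h x = ∫ x, r x * h (x - s • v) := by
        rw [← integral_add_right_eq_self (fun x => r x * h (x - s • v)) (s • v)]
        simp
      simp_rw [hq1, hq2, sub_mul, mul_sub]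
      have i21 : Integrable fun x => B.indicator q x * h (x - s • v) - B.indicator q x * h x :=
        i2.sub i1
      have i43 : Integrable fun x => r x * h (x - s • v) - r x * h x := i4.sub i3
      rw [integral_sub i21 i43, integral_sub i2 i1, integral_sub i4 i3,
        integral_sub i5 i3, e2]
      ring
    rw [e1]
    refine (abs_add_le _ _).trans (add_le_add ?_ ?_)
    · have hqr : Integrable fun x => |B.indicator q x - r x| * 2 := (hqi.sub hri).abs.mul_const 2
      have hle := norm_integral_le_of_norm_le hqr
        (f := fun x => (B.indicator q x - r x) * (h (x - s • v) - h x)) (.of_forall fun x => by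
          rw [Real.norm_eq_abs, abs_mul]
          refine mul_le_mul_of_nonneg_left ?_ (abs_nonneg _)
          exact (abs_sub _ _).trans (by linarith [hb (x - s • v), hb x]))
      rw [integral_mul_const, Real.norm_eq_abs] at hle
      linarith
    · have hsupp : ∀ x, x ∉ Metric.closedBall (0 : Euc n) R → (r (x + s • v) - r x) * h x = 0 :=
        fun x hx => by rw [hs x hx, mul_zero]
      rw [← setIntegral_eq_integral_of_forall_compl_eq_zero hsupp]
      have h7 := norm_setIntegral_le_of_norm_le_const (μ := (volume : Measure (Euc n)))
        (s := Metric.closedBall (0 : Euc n) R) (C := L * (t * ‖v‖))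
        (f := fun x => (r (x + s • v) - r x) * h x) measure_closedBall_lt_top (fun x _ => by
          rw [Real.norm_eq_abs, abs_mul]
          have a1 := hlip (x + s • v) x
          rw [add_sub_cancel_left, norm_smul, Real.norm_of_nonneg hst.1] at a1
          calc _ ≤ L * (s * ‖v‖) * 1 := mul_le_mul a1 (hb x) (abs_nonneg _) (by
                have := hst.1; positivity)
            _ ≤ L * (t * ‖v‖) := by
                rw [mul_one]
                exact mul_le_mul_of_nonneg_left
                  (mul_le_mul_of_nonneg_right hst.2 (norm_nonneg _)) hL0)
      rw [Real.norm_eq_abs] at h7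
      refine h7.trans (le_of_eq ?_)
      rw [hV, Measure.real]
      ring
  have hder : ∀ s, HasDerivAt (fun s : ℝ => (∫ x, f x * h (x - s • v)) - s * ∫ x, q x * h x)
      ((∫ x, q x * h (x - s • v)) - ∫ x, q x * h x) s := by
    intro s
    have := (hw.hasDerivAt_integral_translate hh hc v s).sub
      ((hasDerivAt_id s).mul_const (∫ x, q x * h x))
    simp only [one_mul] at this
    exact this
  have h8 := norm_image_sub_le_of_norm_deriv_le_segment' (a := 0) (b := t)
    (fun s _ => (hder s).hasDerivWithinAt) (fun s hs => key s ⟨hs.1, hs.2.le⟩) t ⟨ht.1, le_rfl⟩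
  simp only [zero_smul, sub_zero, zero_mul, Real.norm_eq_abs] at h8
  calc _ = |((∫ x, f x * h (x - t • v)) - t * ∫ x, q x * h x) - ∫ x, f x * h x| := by
        congr 1; ring
    _ ≤ _ := h8
    _ = _ := by ring

/-- The integral of f over the translate A + tv is nonnegative and vanishes at t = 0, so its right
derivative at 0, which is the integral of ⟨G, v⟩ over A, cannot be negative. -/
lemma HasWeakGradient.setIntegral_nonneg_of_subset_zero {f : Euc n → ℝ} {G : Euc n → Euc n}
    (hw : HasWeakGradient f G) (hf : ∀ x, 0 ≤ f x) (v : Euc n) {R : ℝ} (hR : 0 < R)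
    {A : Set (Euc n)} (hA : MeasurableSet A) (hAf : ∀ x ∈ A, f x = 0)
    (hAR : A ⊆ Metric.closedBall 0 R) : 0 ≤ ∫ x in A, inner ℝ (G x) v := by
  let b : ContDiffBump (0 : Euc n) := ⟨R, R + 1, hR, by linarith⟩
  obtain ⟨h₀, h1, h2, h3, h4⟩ := exists_contDiff_seq_tendsto_ae (gaussN n) (M := 1)
    (g := A.indicator fun _ => (1 : ℝ))
    ((measurable_const.indicator hA).aestronglyMeasurable) one_pos (fun x => by
      by_cases hx : x ∈ A <;> simp [hx])
  rw [gaussN_ae_iff] at h4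
  -- The bump equals 1 on A and confines all the supports to one ball, as the uniform expansion
  -- requires.
  set h : ℕ → Euc n → ℝ := fun k x => b x * h₀ k x with hh
  have hs : ∀ k, ContDiff ℝ ∞ (h k) := fun k => b.contDiff.mul (h1 k)
  have hcs : ∀ k, HasCompactSupport (h k) := fun k => b.hasCompactSupport.mul_right
  have hb : ∀ k x, |h k x| ≤ 1 := fun k x => by
    rw [hh, abs_mul, abs_of_nonneg b.nonneg]
    exact mul_le_one₀ b.le_one (abs_nonneg _) (h3 k x)
  have hz : ∀ k x, x ∉ Metric.closedBall (0 : Euc n) (R + 1) → h k x = 0 := fun k x hx => by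
    have : b x = 0 := b.zero_of_le_dist (by
      rw [Metric.mem_closedBall, not_le] at hx
      exact hx.le)
    rw [hh]; simp [this]
  have hlim : ∀ᵐ x, Tendsto (fun k => h k x) atTop (𝓝 (A.indicator (fun _ => (1 : ℝ)) x)) := by
    filter_upwards [h4] with x hx
    have := hx.const_mul (b x)
    by_cases hxA : x ∈ A
    · rw [b.one_of_mem_closedBall (hAR hxA)] at this
      simpa [hh, hxA, b.one_of_mem_closedBall (hAR hxA)] using this
    · simpa [hh, hxA] using this
  have hconv : ∀ (u : Euc n → ℝ), LocallyIntegrable u → ∀ w : Euc n,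
      Tendsto (fun k => ∫ x, u x * h k (x - w)) atTop
        (𝓝 (∫ x, u x * A.indicator (fun _ => (1 : ℝ)) (x - w))) := by
    intro u hu w
    set B := Metric.closedBall (0 : Euc n) (R + 1 + ‖w‖) with hB
    have hui : Integrable (B.indicator fun x => |u x|) := IntegrableOn.integrable_indicator
      (hu.integrableOn_isCompact (isCompact_closedBall _ _)).abs
      Metric.isClosed_closedBall.measurableSet
    refine tendsto_integral_of_dominated_convergence (B.indicator fun x => |u x|)
      (fun k => ?_) hui (fun k => .of_forall fun x => ?_) ?_
    · exact hu.aestronglyMeasurable.mul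
        (((hs k).continuous.comp (by fun_prop)).aestronglyMeasurable)
    · rw [Real.norm_eq_abs, abs_mul]
      by_cases hx : x ∈ B
      · rw [Set.indicator_of_mem hx]
        exact mul_le_of_le_one_right (abs_nonneg _) (hb k _)
      · rw [hz k (x - w), abs_zero, mul_zero]
        · exact Set.indicator_nonneg (fun _ _ => abs_nonneg _) _
        · intro hx'
          refine hx ?_
          rw [hB, mem_closedBall_zero_iff]
          rw [mem_closedBall_zero_iff] at hx'
          calc ‖x‖ = ‖(x - w) + w‖ := by simp
            _ ≤ R + 1 + ‖w‖ := (norm_add_le _ _).trans (by linarith)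
    · have := (measurePreserving_sub_right (volume : Measure (Euc n)) w).quasiMeasurePreserving.ae hlim
      filter_upwards [this] with x hx
      exact hx.const_mul _
  have hq : LocallyIntegrable fun x => inner ℝ (G x) v := by
    intro x
    obtain ⟨s, hs1, hs2⟩ := hw.2.1 x
    exact ⟨s, hs1, hs2.inner_const v⟩
  have main : ∀ η : ℝ, 0 < η → -(2 * η) ≤ ∫ x in A, inner ℝ (G x) v := by
    intro η hη
    obtain ⟨C, hC⟩ := hw.exists_translate_bound v (R + 1) hη
    have hqA : ∫ x, inner ℝ (G x) v * A.indicator (fun _ => (1 : ℝ)) (x - 0) =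
        ∫ x in A, inner ℝ (G x) v := by
      rw [← integral_indicator hA]
      congr 1
      ext x
      by_cases hx : x ∈ A <;> simp [hx]
    have hf0 : ∫ x, f x * A.indicator (fun _ => (1 : ℝ)) (x - 0) = 0 := by
      rw [← integral_zero (Euc n) ℝ]
      congr 1
      ext x
      by_cases hx : x ∈ A <;> simp [hx, hAf]
    have hpt : ∀ t ∈ Set.Ioc (0 : ℝ) 1, -(2 * η + C * t) ≤ ∫ x in A, inner ℝ (G x) v := by
      intro t ht
      have l1 := hconv f hw.1 (t • v)
      have l2 := hconv f hw.1 0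
      have l3 := hconv _ hq 0
      rw [hf0] at l2
      rw [hqA] at l3
      simp only [sub_zero] at l2 l3
      have l4 := le_of_tendsto ((l1.sub l2).sub (l3.const_mul t)).abs (.of_forall fun k =>
        hC (h k) (hs k) (hcs k) (hb k) (hz k) t ⟨ht.1.le, ht.2⟩)
      have l5 : 0 ≤ ∫ x, f x * A.indicator (fun _ => (1 : ℝ)) (x - t • v) :=
        integral_nonneg fun x => mul_nonneg (hf x)
          (Set.indicator_nonneg (fun _ _ => zero_le_one) _)
      have l6 := (abs_le.1 l4).2
      have l7 : t * (-(2 * η + C * t)) ≤ t * ∫ x in A, inner ℝ (G x) v := by linarith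
      exact le_of_mul_le_mul_left l7 ht.1
    -- After division by t, the limit t → 0⁺ removes the term C t, although C depends on η.
    have hlimt : Tendsto (fun t : ℝ => -(2 * η + C * t)) (𝓝[>] 0) (𝓝 (-(2 * η + C * 0))) :=
      (Continuous.tendsto (by fun_prop) 0).mono_left nhdsWithin_le_nhds
    rw [mul_zero, add_zero] at hlimt
    exact le_of_tendsto hlimt (by
      filter_upwards [Ioc_mem_nhdsGT (zero_lt_one (α := ℝ))] with t ht using hpt t ht)
  by_contra hneg
  push Not at hneg
  have := main (-(∫ x in A, inner ℝ (G x) v) / 4) (by linarith)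
  linarith

/-- The weak gradient of a nonnegative function vanishes almost everywhere on its zero set. -/
lemma HasWeakGradient.eq_zero_of_eq_zero {f : Euc n → ℝ} {G : Euc n → Euc n}
    (hw : HasWeakGradient f G) (hm : Measurable f) (hf : ∀ x, 0 ≤ f x) :
    ∀ᵐ x, f x = 0 → G x = 0 := by
  have hZ : MeasurableSet {x | f x = 0} := hm (measurableSet_singleton 0)
  have h1 : ∀ (v : Euc n) (k : ℕ), ∀ᵐ x, f x = 0 → x ∈ Metric.closedBall (0 : Euc n) (k + 1) →
      0 ≤ inner ℝ (G x) v := by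
    intro v k
    have hB : MeasurableSet (Metric.closedBall (0 : Euc n) (k + 1)) :=
      Metric.isClosed_closedBall.measurableSet
    have hi : IntegrableOn (fun x => inner ℝ (G x) v)
        ({x | f x = 0} ∩ Metric.closedBall (0 : Euc n) (k + 1)) :=
      IntegrableOn.mono_set (((hw.2.1.integrableOn_isCompact (isCompact_closedBall _ _))).inner_const v)
        Set.inter_subset_right
    have := ae_nonneg_of_forall_setIntegral_nonneg hi (fun s hs _ => by
      rw [Measure.restrict_restrict hs]
      exact hw.setIntegral_nonneg_of_subset_zero hf v (R := k + 1) (by positivity)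
        (hs.inter (hZ.inter hB)) (fun x hx => hx.2.1) (fun x hx => hx.2.2))
    rw [EventuallyLE, ae_restrict_iff' (hZ.inter hB)] at this
    filter_upwards [this] with x hx h2 h3 using hx ⟨h2, h3⟩
  -- Using both signs of each basis vector turns nonnegativity of the pairings into vanishing of
  -- each coordinate.
  have h2 : ∀ i : Fin n, ∀ᵐ x, ∀ k : ℕ, f x = 0 → x ∈ Metric.closedBall (0 : Euc n) (k + 1) →
      0 ≤ inner ℝ (G x) (EuclideanSpace.single i 1) ∧
      0 ≤ inner ℝ (G x) (-EuclideanSpace.single i 1) := fun i => ae_all_iff.2 fun k => by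
    filter_upwards [h1 (EuclideanSpace.single i 1) k, h1 (-EuclideanSpace.single i 1) k]
      with x ha hb hc hd using ⟨ha hc hd, hb hc hd⟩
  filter_upwards [ae_all_iff.2 h2] with x hx h0
  obtain ⟨k, hk⟩ := exists_nat_gt ‖x‖
  ext i
  have := hx i k h0 (by rw [mem_closedBall_zero_iff]; linarith)
  simp only [EuclideanSpace.inner_single_right, inner_neg_right] at this
  simp at this ⊢
  linarith

/-! ### Gaussian averages of functions that are constant off a compact set -/

/-- The `i`-th partial derivative. -/
noncomputable def pderivAt (i : Fin n) (F : Euc n → ℝ) (x : Euc n) : ℝ :=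
  fderiv ℝ F x (EuclideanSpace.single i 1)

/-- Smooth functions that are constant outside some compact set. -/
def IsConstOffCompact (F : Euc n → ℝ) : Prop :=
  ContDiff ℝ ∞ F ∧ ∃ c, HasCompactSupport fun x => F x - c

lemma fderiv_apply_eq_sum (F : Euc n → ℝ) (x v : Euc n) :
    fderiv ℝ F x v = ∑ i, v i * pderivAt i F x := by
  have hv : v = ∑ i, v i • EuclideanSpace.single i (1 : ℝ) := by
    simpa using ((EuclideanSpace.basisFun (Fin n) ℝ).sum_repr v).symm
  conv_lhs => rw [hv]
  simp [map_sum, pderivAt]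

lemma norm_fderiv_sq_eq_sum (F : Euc n → ℝ) (x : Euc n) :
    ‖fderiv ℝ F x‖ ^ 2 = ∑ i, pderivAt i F x ^ 2 := by
  have := (EuclideanSpace.basisFun (Fin n) ℝ).norm_dual (fderiv ℝ F x)
  simpa [pderivAt] using this

lemma abs_pderivAt_le (i : Fin n) (F : Euc n → ℝ) (x : Euc n) :
    |pderivAt i F x| ≤ ‖fderiv ℝ F x‖ := by
  have := (fderiv ℝ F x).le_opNorm (EuclideanSpace.single i 1)
  simpa [pderivAt] using this

lemma norm_fderiv_le_sum (F : Euc n → ℝ) (x : Euc n) :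
    ‖fderiv ℝ F x‖ ≤ ∑ i, |pderivAt i F x| := by
  refine ContinuousLinearMap.opNorm_le_bound _ (Finset.sum_nonneg fun i _ => abs_nonneg _) fun v => ?_
  rw [fderiv_apply_eq_sum, Finset.sum_mul]
  refine (norm_sum_le _ _).trans (Finset.sum_le_sum fun i _ => ?_)
  rw [norm_mul, mul_comm, Real.norm_eq_abs]
  exact mul_le_mul_of_nonneg_left (PiLp.norm_apply_le v i) (abs_nonneg _)

lemma contDiff_pderivAt {F : Euc n → ℝ} (hF : ContDiff ℝ ∞ F) (i : Fin n) :
    ContDiff ℝ ∞ (pderivAt i F) :=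
  (hF.fderiv_right (m := ∞) (by simp)).clm_apply contDiff_const

namespace IsConstOffCompact

lemma of_hasCompactSupport {F : Euc n → ℝ} (hF : ContDiff ℝ ∞ F) (hc : HasCompactSupport F) :
    IsConstOffCompact F :=
  ⟨hF, 0, by simpa using hc⟩

lemma exists_bound {F : Euc n → ℝ} (hF : IsConstOffCompact F) : ∃ C, ∀ x, |F x| ≤ C := by
  obtain ⟨h1, c, h2⟩ := hF
  obtain ⟨C, hC⟩ := h2.exists_bound_of_continuous (h1.continuous.sub continuous_const)
  refine ⟨C + |c|, fun x => ?_⟩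
  calc |F x| = |(F x - c) + c| := by simp
    _ ≤ C + |c| := (abs_add_le _ _).trans (by gcongr; exact hC x)

lemma hasCompactSupport_fderiv {F : Euc n → ℝ} (hF : IsConstOffCompact F) :
    HasCompactSupport (fderiv ℝ F) := by
  obtain ⟨h1, c, h2⟩ := hF
  have := h2.fderiv ℝ
  rwa [show (fderiv ℝ fun x => F x - c) = fderiv ℝ F from funext fun x => fderiv_sub_const c]
    at this

lemma exists_bound_fderiv {F : Euc n → ℝ} (hF : IsConstOffCompact F) :
    ∃ C, ∀ x, ‖fderiv ℝ F x‖ ≤ C :=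
  hF.hasCompactSupport_fderiv.exists_bound_of_continuous (hF.1.continuous_fderiv (by simp))

lemma pderivAt {F : Euc n → ℝ} (hF : IsConstOffCompact F) (i : Fin n) :
    IsConstOffCompact (pderivAt i F) :=
  of_hasCompactSupport (contDiff_pderivAt hF.1 i)
    (hF.hasCompactSupport_fderiv.comp_left
      (g := fun (L : Euc n →L[ℝ] ℝ) => L (EuclideanSpace.single i 1)) (by simp))

end IsConstOffCompact

/-- The average `∫ φ(y + σ z) dγ(z)`. -/
noncomputable def gaussAvg (σ : ℝ) (φ : Euc n → ℝ) (y : Euc n) : ℝ :=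
  ∫ z, φ (y + σ • z) ∂(gaussN n)

lemma abs_gaussAvg_le {φ : Euc n → ℝ} {C : ℝ} (hC : ∀ x, |φ x| ≤ C) (σ : ℝ) (y : Euc n) :
    |gaussAvg σ φ y| ≤ C := by
  have := norm_integral_le_of_norm_le_const (μ := gaussN n) (f := fun z => φ (y + σ • z))
    (.of_forall fun z => hC (y + σ • z))
  simpa [gaussAvg] using this

lemma integrable_of_continuous_bounded {α : Type*} [TopologicalSpace α] [MeasurableSpace α]
    [OpensMeasurableSpace α] {μ : Measure α} [IsFiniteMeasure μ] {φ : α → ℝ}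
    [SecondCountableTopologyEither α ℝ]
    (hφ : Continuous φ) {C : ℝ} (hC : ∀ x, |φ x| ≤ C) : Integrable φ μ :=
  Integrable.of_bound hφ.aestronglyMeasurable C (.of_forall hC)

lemma le_gaussAvg {φ : Euc n → ℝ} (hφ : Continuous φ) {C a : ℝ} (hC : ∀ x, |φ x| ≤ C)
    (ha : ∀ x, a ≤ φ x) (σ : ℝ) (y : Euc n) : a ≤ gaussAvg σ φ y := by
  have h1 : ∫ _z : Euc n, a ∂(gaussN n) ≤ gaussAvg σ φ y :=
    integral_mono (integrable_const _)
      (integrable_of_continuous_bounded (by fun_prop) fun z => hC _) fun z => ha _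
  simpa using h1

lemma gaussAvg_zero (φ : Euc n → ℝ) (y : Euc n) : gaussAvg 0 φ y = φ y := by
  simp [gaussAvg]

/-- Viewing the average as a convolution against the law of −σZ lets smoothness in y come from
smoothness of φ, also in the degenerate case σ = 0. -/
lemma gaussAvg_eq_convolution {φ : Euc n → ℝ} (hφ : Continuous φ) (σ : ℝ) (y : Euc n) :
    gaussAvg σ φ y = convolution (fun _ : Euc n => (1 : ℝ)) φ (ContinuousLinearMap.mul ℝ ℝ)
      ((gaussN n).map fun z => -(σ • z)) y := by
  rw [convolution, integral_map (by fun_prop) (Continuous.aestronglyMeasurable (by fun_prop))]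
  simp [gaussAvg]

lemma gaussAvg_const_add {φ : Euc n → ℝ} (hφ : Continuous φ) {C : ℝ} (hC : ∀ x, |φ x| ≤ C)
    (c σ : ℝ) (y : Euc n) : gaussAvg σ (fun x => φ x - c) y = gaussAvg σ φ y - c := by
  unfold gaussAvg
  rw [integral_sub (integrable_of_continuous_bounded (by fun_prop) fun z => hC _)
    (integrable_const _)]
  simp

instance isProbabilityMeasure_map_neg_smul (σ : ℝ) :
    IsProbabilityMeasure ((gaussN n).map fun z => -(σ • z)) :=
  Measure.isProbabilityMeasure_map (by fun_prop)

lemma IsConstOffCompact.gaussAvg_aux {F : Euc n → ℝ} (hF : IsConstOffCompact F) (σ : ℝ) :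
    ContDiff ℝ ∞ (gaussAvg σ F) ∧
      ∀ (i : Fin n) y, _root_.pderivAt i (gaussAvg σ F) y = gaussAvg σ (_root_.pderivAt i F) y := by
  obtain ⟨C, hC⟩ := hF.exists_bound
  have hd := hF.hasCompactSupport_fderiv
  obtain ⟨h1, c, h2⟩ := hF
  -- Smoothness of the convolution needs a compactly supported factor, so the constant value at
  -- infinity is subtracted and restored afterwards.
  set φ : Euc n → ℝ := fun x => F x - c with hφ
  have hφs : ContDiff ℝ ∞ φ := h1.sub contDiff_const
  have h3 : gaussAvg σ φ = fun y => gaussAvg σ F y - c := by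
    ext y; exact gaussAvg_const_add h1.continuous hC c σ y
  have h4 : gaussAvg σ φ = convolution (fun _ : Euc n => (1 : ℝ)) φ (ContinuousLinearMap.mul ℝ ℝ)
      ((gaussN n).map fun z => -(σ • z)) := by
    ext y; exact gaussAvg_eq_convolution hφs.continuous σ y
  have hl : LocallyIntegrable (fun _ : Euc n => (1 : ℝ)) ((gaussN n).map fun z => -(σ • z)) :=
    locallyIntegrable_const _
  have h5 : gaussAvg σ F = fun y => gaussAvg σ φ y + c := by
    ext y; rw [h3]; ring
  constructor
  · rw [h5, h4]
    exact (h2.contDiff_convolution_right (n := ⊤) _ hl hφs).add contDiff_const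
  · intro i y
    obtain ⟨D, hD⟩ := hd.exists_bound_of_continuous (h1.continuous_fderiv (by simp))
    have hfd : Continuous (fderiv ℝ F) := h1.continuous_fderiv (by simp)
    have hFc := h1.continuous
    have hdi : ∀ y, Integrable (fun z => fderiv ℝ F (y + σ • z)) (gaussN n) := fun y =>
      Integrable.of_bound (Continuous.aestronglyMeasurable (by fun_prop)) D
        (.of_forall fun z => hD _)
    have h6 : HasFDerivAt (gaussAvg σ F) (∫ z, fderiv ℝ F (y + σ • z) ∂(gaussN n)) y :=
      hasFDerivAt_integral_of_dominated_of_fderiv_le (bound := fun _ => D)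
        (F := fun y z => F (y + σ • z)) (F' := fun y z => fderiv ℝ F (y + σ • z)) Filter.univ_mem
        (.of_forall fun y => Continuous.aestronglyMeasurable (by fun_prop))
        (integrable_of_continuous_bounded (by fun_prop) fun z => hC _) (hdi y).1
        (.of_forall fun z x _ => hD _) (integrable_const _)
        (.of_forall fun z x _ => (hasFDerivAt_comp_add_right _).2 (h1.differentiable (by simp) _).hasFDerivAt)
    rw [_root_.pderivAt, h6.fderiv, ContinuousLinearMap.integral_apply (hdi y)]
    rfl

lemma IsConstOffCompact.contDiff_gaussAvg {F : Euc n → ℝ} (hF : IsConstOffCompact F) (σ : ℝ) :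
    ContDiff ℝ ∞ (gaussAvg σ F) := (hF.gaussAvg_aux σ).1

lemma IsConstOffCompact.pderivAt_gaussAvg {F : Euc n → ℝ} (hF : IsConstOffCompact F) (σ : ℝ)
    (i : Fin n) (y : Euc n) :
    _root_.pderivAt i (gaussAvg σ F) y = gaussAvg σ (_root_.pderivAt i F) y :=
  (hF.gaussAvg_aux σ).2 i y

lemma inner_single_one (x : Euc n) (i : Fin n) :
    inner ℝ x (EuclideanSpace.single i (1 : ℝ)) = x i := by
  simp [EuclideanSpace.inner_single_right]

lemma pderivAt_comp_affine {h : Euc n → ℝ} (hh : Differentiable ℝ h) (y : Euc n) (σ : ℝ)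
    (i : Fin n) (z : Euc n) :
    pderivAt i (fun z => h (y + σ • z)) z = σ * pderivAt i h (y + σ • z) := by
  have h1 : HasFDerivAt (fun z : Euc n => y + σ • z) (σ • ContinuousLinearMap.id ℝ (Euc n)) z :=
    ((hasFDerivAt_id z).const_smul σ).const_add y
  have h2 := ((hh (y + σ • z)).hasFDerivAt.comp z h1).fderiv
  rw [Function.comp_def] at h2
  rw [pderivAt, h2]
  simp [pderivAt]

lemma norm_fderiv_comp_affine_le {h : Euc n → ℝ} (hh : Differentiable ℝ h) {C : ℝ}
    (hC : ∀ x, ‖fderiv ℝ h x‖ ≤ C) (y : Euc n) (σ : ℝ) (z : Euc n) :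
    ‖fderiv ℝ (fun z => h (y + σ • z)) z‖ ≤ C * |σ| := by
  have h1 : HasFDerivAt (fun z : Euc n => y + σ • z) (σ • ContinuousLinearMap.id ℝ (Euc n)) z :=
    ((hasFDerivAt_id z).const_smul σ).const_add y
  have h2 := ((hh (y + σ • z)).hasFDerivAt.comp z h1).fderiv
  rw [Function.comp_def] at h2
  rw [h2, ContinuousLinearMap.comp_smul, ContinuousLinearMap.comp_id, norm_smul, mul_comm,
    Real.norm_eq_abs]
  exact mul_le_mul_of_nonneg_right (hC _) (abs_nonneg _)

/-- Stein's identity for a function composed with an affine map. -/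
lemma stein_affine {h : Euc n → ℝ} (hh : ContDiff ℝ ∞ h) {C : ℝ} (hb : ∀ x, |h x| ≤ C)
    (hb' : ∀ x, ‖fderiv ℝ h x‖ ≤ C) (i : Fin n) (y : Euc n) (σ : ℝ) :
    ∫ z, z i * h (y + σ • z) ∂(gaussN n) = σ * ∫ z, pderivAt i h (y + σ • z) ∂(gaussN n) := by
  have hC : 0 ≤ C := (abs_nonneg _).trans (hb 0)
  have hd := hh.differentiable (by simp)
  -- The constant C |σ| + C is a crude common bound for the composed function and its derivative.
  have := stein_gaussN (h := fun z => h (y + σ • z)) (hh.comp (by fun_prop))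
    (C := C * |σ| + C) (fun z => (hb _).trans (by nlinarith [mul_nonneg hC (abs_nonneg σ)]))
    (fun z => (norm_fderiv_comp_affine_le hd hb' y σ z).trans (by linarith))
    (EuclideanSpace.single i 1)
  simp only [inner_single_one] at this
  rw [this, ← integral_const_mul]
  exact integral_congr_ae (.of_forall fun z => pderivAt_comp_affine hd y σ i z)

/-! ### Bessel's inequality for linear functions -/

lemma integral_inner_gaussN (a : Euc n) : ∫ z, inner ℝ a z ∂(gaussN n) = 0 :=
  integral_strongDual_stdGaussian (innerSL ℝ a)

lemma memLp_inner_gaussN (a : Euc n) : MemLp (fun z => inner ℝ a z) 2 (gaussN n) :=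
  IsGaussian.memLp_dual (gaussN n) (innerSL ℝ a) 2 (by simp)

lemma integral_inner_sq_gaussN (a : Euc n) : ∫ z, inner ℝ a z ^ 2 ∂(gaussN n) = ‖a‖ ^ 2 := by
  have h := variance_dual_stdGaussian (E := Euc n) (innerSL ℝ a)
  have h0 : ∫ z, innerSL ℝ a z ∂(gaussN n) = 0 := integral_inner_gaussN a
  rw [variance_of_integral_eq_zero (by fun_prop) h0, innerSL_apply_norm] at h
  exact h

/-- Under γ the constant 1 and the coordinates are orthonormal. The inequality is the nonnegativity
of the squared distance from k to its projection m + ⟨a, z⟩ onto their span. -/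
lemma bessel_gaussN {k : Euc n → ℝ} (hk : Continuous k) {C : ℝ} (hC : ∀ x, |k x| ≤ C) :
    ∑ i, (∫ z, z i * k z ∂(gaussN n)) ^ 2 ≤
      ∫ z, k z ^ 2 ∂(gaussN n) - (∫ z, k z ∂(gaussN n)) ^ 2 := by
  set a : Euc n := WithLp.toLp 2 fun i => ∫ z, z i * k z ∂(gaussN n) with ha
  set m := ∫ z, k z ∂(gaussN n) with hm
  have ik : Integrable k (gaussN n) := integrable_of_continuous_bounded hk hC
  have ik2 : Integrable (fun z => k z ^ 2) (gaussN n) :=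
    integrable_of_continuous_bounded (by fun_prop) (C := C ^ 2) fun z => by
      rw [abs_pow]; exact pow_le_pow_left₀ (abs_nonneg _) (hC z) 2
  have ii : Integrable (fun z => inner ℝ a z) (gaussN n) :=
    (memLp_inner_gaussN a).integrable (by simp)
  have ii2 : Integrable (fun z => inner ℝ a z ^ 2) (gaussN n) := (memLp_inner_gaussN a).integrable_sq
  have izk : ∀ i, Integrable (fun z : Euc n => z i * k z) (gaussN n) := fun i => by
    refine Integrable.mul_bdd (c := C) ?_ hk.aestronglyMeasurable (.of_forall hC)
    have := (memLp_inner_gaussN (EuclideanSpace.single i (1 : ℝ))).integrable (by simp)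
    simpa [EuclideanSpace.inner_single_left] using this
  have hin : ∀ z : Euc n, inner ℝ a z * k z = ∑ i, a i * (z i * k z) := fun z => by
    rw [PiLp.inner_apply, Finset.sum_mul]
    refine Finset.sum_congr rfl fun i _ => ?_
    simp
    ring
  have iik : Integrable (fun z => inner ℝ a z * k z) (gaussN n) := by
    simp_rw [hin]
    exact integrable_finsetSum _ fun i _ => (izk i).const_mul _
  have e1 : ∫ z, inner ℝ a z * k z ∂(gaussN n) = ‖a‖ ^ 2 := by
    simp_rw [hin]
    rw [integral_finsetSum _ fun i _ => (izk i).const_mul _, EuclideanSpace.real_norm_sq_eq]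
    refine Finset.sum_congr rfl fun i _ => ?_
    rw [integral_const_mul, pow_two]
  have e2 : 0 ≤ ∫ z, (k z ^ 2 - 2 * (inner ℝ a z * k z) - 2 * m * k z + inner ℝ a z ^ 2 +
      (2 * m * inner ℝ a z + m ^ 2)) ∂(gaussN n) := by
    refine integral_nonneg fun z => ?_
    have : k z ^ 2 - 2 * (inner ℝ a z * k z) - 2 * m * k z + inner ℝ a z ^ 2 +
      (2 * m * inner ℝ a z + m ^ 2) = (k z - m - inner ℝ a z) ^ 2 := by ring
    simp only [Pi.zero_apply, this]
    positivity
  have j1 := ik2.sub (iik.const_mul 2)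
  have j2 := j1.sub (ik.const_mul (2 * m))
  have j3 := j2.add ii2
  have j4 := (ii.const_mul (2 * m)).add (integrable_const (m ^ 2))
  erw [integral_add j3 j4, integral_add j2 ii2, integral_sub j1 (ik.const_mul (2 * m)),
    integral_sub ik2 (iik.const_mul 2), integral_add (ii.const_mul (2 * m)) (integrable_const _)]
    at e2
  rw [integral_const_mul, integral_const_mul, integral_const_mul, e1, integral_inner_sq_gaussN,
    integral_inner_gaussN, integral_const, ← hm] at e2
  simp only [probReal_univ, one_smul] at e2
  rw [EuclideanSpace.real_norm_sq_eq] at e2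
  have e3 : ∑ i, a i ^ 2 = ∑ i, (∫ z, z i * k z ∂(gaussN n)) ^ 2 := rfl
  rw [← e3]
  nlinarith

/-! ### Consequences of the Poincaré inequality -/

lemma norm_gradient_eq (g : Euc n → ℝ) (x : Euc n) : ‖gradient g x‖ = ‖fderiv ℝ g x‖ := by
  simp [gradient]

/-- The defining inequality applied to g minus its mean, transferred from [0, ∞] to real integrals.
-/
lemma poincare_bounded {ν : Measure (Euc n)} {lam : ℝ} (hlam : 0 < lam)
    (hν : ν ∈ poincareClass n lam) {g : Euc n → ℝ} (hg : ContDiff ℝ ∞ g) {C : ℝ}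
    (hC : ∀ x, |g x| ≤ C) (hC' : ∀ x, ‖fderiv ℝ g x‖ ≤ C) :
    lam * (∫ x, g x ^ 2 ∂ν - (∫ x, g x ∂ν) ^ 2) ≤ ∫ x, ‖fderiv ℝ g x‖ ^ 2 ∂ν := by
  obtain ⟨hp, h⟩ := hν
  set m := ∫ x, g x ∂ν with hm
  have hc := hg.continuous
  have hfc : Continuous (fderiv ℝ g) := hg.continuous_fderiv (by simp)
  have ig : Integrable g ν := integrable_of_continuous_bounded hc hC
  have ig2 : Integrable (fun x => g x ^ 2) ν :=
    integrable_of_continuous_bounded (by fun_prop) (C := C ^ 2) fun z => by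
      rw [abs_pow]; exact pow_le_pow_left₀ (abs_nonneg _) (hC z) 2
  have h1 := h (fun x => g x - m) (hg.sub contDiff_const) (ig.sub (integrable_const m)) (by
    rw [integral_sub ig (integrable_const m)]; simp [hm])
  have igm : Integrable (fun x => (g x - m) ^ 2) ν := by
    have : (fun x => (g x - m) ^ 2) = fun x => g x ^ 2 - 2 * m * g x + m ^ 2 := by ext; ring
    rw [this]
    exact (ig2.sub (ig.const_mul _)).add (integrable_const _)
  have ifd : Integrable (fun x => ‖fderiv ℝ g x‖ ^ 2) ν :=
    integrable_of_continuous_bounded (by fun_prop) (C := C ^ 2) fun z => by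
      rw [abs_pow, abs_norm]; exact pow_le_pow_left₀ (norm_nonneg _) (hC' z) 2
  have e1 : ∀ x, ‖gradient (fun x => g x - m) x‖ ^ 2 = ‖fderiv ℝ g x‖ ^ 2 := fun x => by
    rw [norm_gradient_eq, fderiv_sub_const]
  simp_rw [e1] at h1
  rw [← ofReal_integral_eq_lintegral_ofReal igm (.of_forall fun x => sq_nonneg _),
    ← ofReal_integral_eq_lintegral_ofReal ifd (.of_forall fun x => sq_nonneg _),
    ← ENNReal.ofReal_mul hlam.le,
    ENNReal.ofReal_le_ofReal_iff (integral_nonneg fun x => sq_nonneg _)] at h1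
  have e2 : ∫ x, (g x - m) ^ 2 ∂ν = ∫ x, g x ^ 2 ∂ν - m ^ 2 := by
    have : (fun x => (g x - m) ^ 2) = fun x => g x ^ 2 - (2 * m * g x - m ^ 2) := by ext; ring
    have i3 : Integrable (fun x => 2 * m * g x - m ^ 2) ν :=
      (ig.const_mul _).sub (integrable_const _)
    rw [this, integral_sub ig2 i3, integral_sub (ig.const_mul _) (integrable_const _), integral_const_mul]
    simp [← hm]
    ring
  rwa [e2] at h1

/-- Measures satisfying a Poincaré inequality have a finite first moment. -/
lemma integrable_coord_of_poincare {ν : Measure (Euc n)} {lam : ℝ} (hlam : 0 < lam)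
    (hν : ν ∈ poincareClass n lam) (i : Fin n) : Integrable (fun x : Euc n => x i) ν := by
  have hp : IsProbabilityMeasure ν := hν.1
  -- Smooth bounded truncations of the coordinate, 1-Lipschitz and converging pointwise to it.
  set g : ℕ → Euc n → ℝ := fun k x => (k + 1 : ℝ) * Real.sin ((k + 1 : ℝ)⁻¹ * x i) with hg
  have hgs : ∀ k, ContDiff ℝ ∞ (g k) := fun k => by
    refine contDiff_const.mul (Real.contDiff_sin.comp (contDiff_const.mul ?_))
    exact (EuclideanSpace.proj i : Euc n →L[ℝ] ℝ).contDiff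
  have hgb : ∀ k x, |g k x| ≤ k + 1 := fun k x => by
    rw [hg, abs_mul, abs_of_pos (by positivity)]
    exact mul_le_of_le_one_right (by positivity) (Real.abs_sin_le_one _)
  have hpr : ‖(EuclideanSpace.proj i : Euc n →L[ℝ] ℝ)‖ ≤ 1 :=
    ContinuousLinearMap.opNorm_le_bound _ zero_le_one fun v => by
      rw [one_mul]; exact PiLp.norm_apply_le v i
  have hgd : ∀ k x, ‖fderiv ℝ (g k) x‖ ≤ 1 := fun k x => by
    have h1 : HasFDerivAt (g k) ((k + 1 : ℝ) • (Real.cos ((k + 1 : ℝ)⁻¹ * x i) •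
        ((k + 1 : ℝ)⁻¹ • (EuclideanSpace.proj i : Euc n →L[ℝ] ℝ)))) x :=
      ((((EuclideanSpace.proj i : Euc n →L[ℝ] ℝ).hasFDerivAt).const_mul _).sin).const_mul _
    rw [h1.fderiv, smul_smul, smul_smul, mul_right_comm, mul_inv_cancel₀ (by positivity), one_mul,
      norm_smul]
    exact mul_le_one₀ (Real.abs_cos_le_one _) (norm_nonneg _) hpr
  -- Doubling the variable expresses twice the variance without the mean of g k, which is not yet
  -- known to stay bounded. Fatou's lemma then applies, and Fubini gives a point y with x i − y i
  -- square-integrable.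
  have hint : ∀ k, ∫⁻ q, ENNReal.ofReal ((g k q.1 - g k q.2) ^ 2) ∂(ν.prod ν) ≤
      ENNReal.ofReal (2 / lam) := by
    intro k
    have hc := (hgs k).continuous
    have i1 : Integrable (g k) ν := integrable_of_continuous_bounded hc (hgb k)
    have i2 : Integrable (fun x => g k x ^ 2) ν :=
      integrable_of_continuous_bounded (by fun_prop) (C := (k + 1 : ℝ) ^ 2) fun z => by
        rw [abs_pow]; exact pow_le_pow_left₀ (abs_nonneg _) (hgb k z) 2
    have j1 : Integrable (fun q : Euc n × Euc n => g k q.1 ^ 2) (ν.prod ν) := i2.comp_fst ν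
    have j2 : Integrable (fun q : Euc n × Euc n => g k q.2 ^ 2) (ν.prod ν) := i2.comp_snd ν
    have j3 : Integrable (fun q : Euc n × Euc n => g k q.1 * g k q.2) (ν.prod ν) := i1.mul_prod i1
    have e0 : (fun q : Euc n × Euc n => (g k q.1 - g k q.2) ^ 2) =
        fun q => g k q.1 ^ 2 + g k q.2 ^ 2 - 2 * (g k q.1 * g k q.2) := by ext; ring
    have e1 : ∫ q, (g k q.1 - g k q.2) ^ 2 ∂(ν.prod ν) =
        2 * (∫ x, g k x ^ 2 ∂ν - (∫ x, g k x ∂ν) ^ 2) := by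
      have j12 : Integrable (fun q : Euc n × Euc n => g k q.1 ^ 2 + g k q.2 ^ 2) (ν.prod ν) :=
        j1.add j2
      rw [e0, integral_sub j12 (j3.const_mul 2), integral_add j1 j2, integral_const_mul,
        integral_prod_mul, integral_fun_fst (fun x => g k x ^ 2),
        integral_fun_snd (fun x => g k x ^ 2)]
      simp
      ring
    rw [← ofReal_integral_eq_lintegral_ofReal (by rw [e0]; exact (j1.add j2).sub (j3.const_mul 2))
      (.of_forall fun x => sq_nonneg _), e1]
    refine ENNReal.ofReal_le_ofReal ?_
    have h2 := poincare_bounded hlam hν (hgs k) (hgb k)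
      (fun x => (hgd k x).trans (by linarith [(Nat.cast_nonneg k : (0 : ℝ) ≤ k)]))
    have h3 : ∫ x, ‖fderiv ℝ (g k) x‖ ^ 2 ∂ν ≤ 1 := by
      have := norm_integral_le_of_norm_le_const (μ := ν) (f := fun x => ‖fderiv ℝ (g k) x‖ ^ 2)
        (C := 1) (.of_forall fun x => by
          rw [norm_pow, norm_norm]; exact pow_le_one₀ (norm_nonneg _) (hgd k x))
      simp only [probReal_univ, mul_one] at this
      exact (le_abs_self _).trans this
    rw [le_div_iff₀ hlam]
    nlinarith
  have hlim : ∀ x : Euc n, Tendsto (fun k => g k x) atTop (𝓝 (x i)) := by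
    intro x
    have h1 : HasDerivAt Real.sin 1 0 := by simpa using Real.hasDerivAt_sin 0
    have hi : Tendsto (fun k : ℕ => ((k : ℝ) + 1)⁻¹) atTop (𝓝[≠] 0) := by
      refine tendsto_nhdsWithin_iff.2 ⟨by
        simpa using (tendsto_one_div_add_atTop_nhds_zero_nat (𝕜 := ℝ)), .of_forall fun k => ?_⟩
      simp only [Set.mem_compl_iff, Set.mem_singleton_iff]
      positivity
    have h2 : HasDerivAt (fun t : ℝ => Real.sin (t * x i)) (x i) 0 := by
      have := (HasDerivAt.sin ((hasDerivAt_id (0 : ℝ)).mul_const (x i)))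
      simpa using this
    have h3 := (hasDerivAt_iff_tendsto_slope.1 h2).comp hi
    refine h3.congr fun k => ?_
    simp [slope, hg]
  have hfat : ∫⁻ q, ENNReal.ofReal ((q.1 i - q.2 i) ^ 2) ∂(ν.prod ν) ≤ ENNReal.ofReal (2 / lam) := by
    have h1 : ∀ q : Euc n × Euc n, ENNReal.ofReal ((q.1 i - q.2 i) ^ 2) =
        liminf (fun k => ENNReal.ofReal ((g k q.1 - g k q.2) ^ 2)) atTop := fun q =>
      (Tendsto.liminf_eq ((ENNReal.continuous_ofReal.tendsto _).comp
        (((hlim q.1).sub (hlim q.2)).pow 2))).symm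
    simp_rw [h1]
    refine (lintegral_liminf_le fun k => ?_).trans ?_
    · have := (hgs k).continuous
      exact Measurable.ennreal_ofReal (Continuous.measurable (by fun_prop))
    · exact liminf_le_of_le (by isBoundedDefault)
        (fun b hb => by obtain ⟨k, hk⟩ := hb.exists; exact hk.trans (hint k))
  have hmeas : Measurable fun q : Euc n × Euc n => ENNReal.ofReal ((q.1 i - q.2 i) ^ 2) :=
    Measurable.ennreal_ofReal (Continuous.measurable (by fun_prop))
  rw [lintegral_prod_symm _ hmeas.aemeasurable] at hfat
  have hfin := ae_lt_top (hmeas.lintegral_prod_left') (ne_top_of_le_ne_top ENNReal.ofReal_ne_top hfat)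
  obtain ⟨y, hy⟩ := hfin.exists
  have hm : AEStronglyMeasurable (fun x : Euc n => x i - y i) ν :=
    Continuous.aestronglyMeasurable (by fun_prop)
  have i3 : Integrable (fun x : Euc n => (x i - y i) ^ 2) ν := by
    refine (lintegral_ofReal_ne_top_iff_integrable (hm.pow 2)
      (.of_forall fun x => sq_nonneg _)).1 hy.ne
  have i4 : Integrable (fun x : Euc n => x i - y i) ν :=
    ((memLp_two_iff_integrable_sq hm).2 i3).integrable (by simp)
  refine (i4.add (integrable_const (y i))).congr (.of_forall fun x => ?_)
  simp

lemma integrable_id_of_poincare {ν : Measure (Euc n)} {lam : ℝ} (hlam : 0 < lam)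
    (hν : ν ∈ poincareClass n lam) : Integrable (fun x : Euc n => x) ν :=
  Integrable.of_eval_piLp fun i => integrable_coord_of_poincare hlam hν i

/-! ### Variance decay along the Ornstein-Uhlenbeck interpolation -/

lemma sq_le_of_abs_le {a C : ℝ} (h : |a| ≤ C) : |a ^ 2| ≤ C ^ 2 := by
  rw [abs_pow]; exact pow_le_pow_left₀ (abs_nonneg _) h 2

/-- With u(x) = E[h(ax + σZ)], Stein's identity gives σ ∂ᵢu(x) = a E[Zᵢ h(ax + σZ)]. Bessel's
inequality thus bounds σ²|∇u|² by a² times the variance of h(ax + σZ) over Z. Integrating this and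
inserting it in the Poincaré inequality for u bounds the variance explained by X in terms of the
residual variance. -/
lemma variance_gaussAvg_le {ν : Measure (Euc n)} {lam : ℝ} (hlam : 0 < lam)
    (hν : ν ∈ poincareClass n lam) {h : Euc n → ℝ} (hh : IsConstOffCompact h) (a σ : ℝ) :
    lam * σ ^ 2 * (∫ x, gaussAvg σ h (a • x) ^ 2 ∂ν - (∫ x, gaussAvg σ h (a • x) ∂ν) ^ 2) ≤
      a ^ 2 * (∫ x, gaussAvg σ (fun y => h y ^ 2) (a • x) ∂ν - ∫ x, gaussAvg σ h (a • x) ^ 2 ∂ν) := by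
  have hp : IsProbabilityMeasure ν := hν.1
  obtain ⟨C₁, hC₁⟩ := hh.exists_bound
  obtain ⟨C₂, hC₂⟩ := hh.exists_bound_fderiv
  set C := max C₁ C₂ with hCdef
  have hC : ∀ x, |h x| ≤ C := fun x => (hC₁ x).trans (le_max_left _ _)
  have hC' : ∀ x, ‖fderiv ℝ h x‖ ≤ C := fun x => (hC₂ x).trans (le_max_right _ _)
  have hC0 : 0 ≤ C := (abs_nonneg _).trans (hC 0)
  have hs := hh.contDiff_gaussAvg σ
  have hcont := hs.continuous
  have hhc := hh.1.continuous
  set u : Euc n → ℝ := fun x => gaussAvg σ h (a • x) with hu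
  have hus : ContDiff ℝ ∞ u := hs.comp (by fun_prop)
  have hub : ∀ x, |u x| ≤ C := fun x => abs_gaussAvg_le hC σ _
  have hup : ∀ i x, pderivAt i u x = a * gaussAvg σ (pderivAt i h) (a • x) := fun i x => by
    have := pderivAt_comp_affine (hs.differentiable (by simp)) 0 a i x
    simp only [zero_add] at this
    rw [hu, this, hh.pderivAt_gaussAvg]
  have hufd : ∀ x, ‖fderiv ℝ u x‖ ≤ ∑ _i : Fin n, |a| * C := fun x => by
    refine (norm_fderiv_le_sum _ _).trans (Finset.sum_le_sum fun i _ => ?_)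
    rw [hup, abs_mul]
    exact mul_le_mul_of_nonneg_left
      (abs_gaussAvg_le (fun x => (abs_pderivAt_le i h x).trans (hC' x)) σ _) (abs_nonneg _)
  have hpt : ∀ x, σ ^ 2 * ‖fderiv ℝ u x‖ ^ 2 ≤
      a ^ 2 * (gaussAvg σ (fun y => h y ^ 2) (a • x) - u x ^ 2) := fun x => by
    rw [norm_fderiv_sq_eq_sum, Finset.mul_sum]
    have hb := bessel_gaussN (k := fun z => h (a • x + σ • z)) (by fun_prop) (fun z => hC _)
    calc _ = a ^ 2 * ∑ i, (∫ z, z i * h (a • x + σ • z) ∂(gaussN n)) ^ 2 := by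
          rw [Finset.mul_sum]
          refine Finset.sum_congr rfl fun i _ => ?_
          rw [stein_affine hh.1 hC hC', hup]
          unfold gaussAvg
          ring
      _ ≤ _ := mul_le_mul_of_nonneg_left hb (sq_nonneg a)
  set D := max C (∑ _i : Fin n, |a| * C) with hD
  have h1 := poincare_bounded hlam hν hus (fun x => (hub x).trans (le_max_left _ _ : _ ≤ D))
    (fun x => (hufd x).trans (le_max_right _ _))
  have hfc : Continuous (fderiv ℝ u) := hus.continuous_fderiv (by simp)
  have i1 : Integrable (fun x => ‖fderiv ℝ u x‖ ^ 2) ν :=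
    integrable_of_continuous_bounded (by fun_prop) fun x => sq_le_of_abs_le (by
      rw [abs_norm]; exact hufd x)
  have huc := hus.continuous
  have i2 : Integrable (fun x => u x ^ 2) ν :=
    integrable_of_continuous_bounded (by fun_prop) fun x => sq_le_of_abs_le (hub x)
  have i3 : Integrable (fun x => gaussAvg σ (fun y => h y ^ 2) (a • x)) ν := by
    have hh2 : ∀ x, |h x ^ 2| ≤ C ^ 2 := fun x => sq_le_of_abs_le (hC x)
    refine Integrable.of_bound ?_ (C ^ 2) (.of_forall fun x => abs_gaussAvg_le hh2 σ _)
    refine (StronglyMeasurable.integral_prod_right (f := fun (x z : Euc n) => h (a • x + σ • z) ^ 2)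
      (Continuous.stronglyMeasurable ?_)).aestronglyMeasurable
    simp only [Function.uncurry_def]
    fun_prop
  have h2 := integral_mono (i1.const_mul (σ ^ 2)) ((i3.sub i2).const_mul (a ^ 2)) hpt
  rw [integral_const_mul, integral_const_mul] at h2
  simp only [Pi.sub_apply] at h2
  rw [integral_sub i3 i2] at h2
  nlinarith [mul_le_mul_of_nonneg_left h1 (sq_nonneg σ)]

/-- The interpolation between `z` and `x`, as a function of the pair `q = (x, z)`. -/
def interp (a σ : ℝ) (q : Euc n × Euc n) : Euc n := a • q.1 + σ • q.2

@[fun_prop]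
lemma continuous_interp (a σ : ℝ) : Continuous (interp (n := n) a σ) := by
  unfold interp; fun_prop

lemma integral_interp_eq {ν : Measure (Euc n)} [IsProbabilityMeasure ν] {h : Euc n → ℝ}
    (hh : Continuous h) {C : ℝ} (hC : ∀ x, |h x| ≤ C) (a σ : ℝ) {ξ : Euc n → ℝ}
    (hξ : Integrable ξ ν) :
    ∫ q, h (interp a σ q) * ξ q.1 ∂(ν.prod (gaussN n)) =
      ∫ x, gaussAvg σ h (a • x) * ξ x ∂ν := by
  have i1 : Integrable (fun q : Euc n × Euc n => h (interp a σ q) * ξ q.1) (ν.prod (gaussN n)) :=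
    (hξ.comp_fst (gaussN n)).bdd_mul (c := C) (Continuous.aestronglyMeasurable (by fun_prop))
      (.of_forall fun q => hC _)
  rw [integral_prod _ i1]
  refine integral_congr_ae (.of_forall fun x => ?_)
  simp only [interp]
  rw [integral_mul_const]
  rfl

/-- Let u = E[h(Y) | X], m = E h(Y), and b the mean of ξ. The pairing with ξ(X) sees only u, and
variance decay gives Var u ≤ θ Var h(Y) with θ = s² / (s² + λc²). So the covariance is at most ½
(Var h(Y) + θ Var ξ). Subtracting ½ E h(Y)² leaves mb − ½m² + ½θ Var ξ, and mb − ½m² ≤ ½b². -/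
lemma score_pairing_le_of_hasCompactSupport {ν : Measure (Euc n)} {lam : ℝ} (hlam : 0 < lam)
    (hν : ν ∈ poincareClass n lam) {h : Euc n → ℝ} (hh : IsConstOffCompact h)
    {s c : ℝ} (hs : 0 < s) (hc : 0 < c) {ξ : Euc n → ℝ} (hξ : MemLp ξ 2 ν) :
    ∫ q, h (interp (s ^ 2) (s * c) q) * ξ q.1 ∂(ν.prod (gaussN n))
      - (1 / 2) * ∫ q, h (interp (s ^ 2) (s * c) q) ^ 2 ∂(ν.prod (gaussN n)) ≤
      (1 / 2) * (s ^ 2 / (s ^ 2 + lam * c ^ 2) * ∫ x, (ξ x - ∫ y, ξ y ∂ν) ^ 2 ∂ν +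
        (∫ y, ξ y ∂ν) ^ 2) := by
  have hp : IsProbabilityMeasure ν := hν.1
  obtain ⟨C, hC⟩ := hh.exists_bound
  have hhc := hh.1.continuous
  have hξi : Integrable ξ ν := hξ.integrable (by simp)
  set b := ∫ y, ξ y ∂ν with hb
  set u : Euc n → ℝ := fun x => gaussAvg (s * c) h (s ^ 2 • x) with hu
  have huc : Continuous u := (hh.contDiff_gaussAvg _).continuous.comp (by fun_prop)
  have hub : ∀ x, |u x| ≤ C := fun x => abs_gaussAvg_le hC _ _
  have e1 := integral_interp_eq hhc hC (s ^ 2) (s * c) hξi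
  have e2 := integral_interp_eq (ν := ν) (h := fun y => h y ^ 2) (by fun_prop)
    (fun x => sq_le_of_abs_le (hC x)) (s ^ 2) (s * c) (integrable_const (1 : ℝ))
  simp only [mul_one] at e2
  have hvar := variance_gaussAvg_le hlam hν hh (s ^ 2) (s * c)
  rw [← e2] at hvar
  rw [e1]
  set Q := ∫ q, h (interp (s ^ 2) (s * c) q) ^ 2 ∂(ν.prod (gaussN n)) with hQ
  set m := ∫ x, u x ∂ν with hm
  set T := ∫ x, u x ^ 2 ∂ν with hT
  set A := ∫ x, (ξ x - b) ^ 2 ∂ν with hA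
  have iu : Integrable u ν := integrable_of_continuous_bounded huc hub
  have iu2 : Integrable (fun x => u x ^ 2) ν :=
    integrable_of_continuous_bounded (by fun_prop) fun x => sq_le_of_abs_le (hub x)
  have iuξ : Integrable (fun x => u x * ξ x) ν :=
    hξi.bdd_mul (c := C) huc.aestronglyMeasurable (.of_forall hub)
  have iξ2 : Integrable (fun x => (ξ x - b) ^ 2) ν := (hξ.sub (memLp_const b)).integrable_sq
  have hV : lam * c ^ 2 * (T - m ^ 2) ≤ s ^ 2 * (Q - T) := by
    have h3 : s ^ 2 * (lam * c ^ 2 * (T - m ^ 2)) ≤ s ^ 2 * (s ^ 2 * (Q - T)) := by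
      calc _ = lam * (s * c) ^ 2 * (T - m ^ 2) := by ring
        _ ≤ _ := hvar
        _ = _ := by ring
    exact le_of_mul_le_mul_left h3 (by positivity)
  set θ := s ^ 2 / (s ^ 2 + lam * c ^ 2) with hθ
  have hd : 0 < s ^ 2 + lam * c ^ 2 := by positivity
  have hθ0 : 0 < θ := by positivity
  have hVθ : θ⁻¹ * (T - m ^ 2) ≤ Q - m ^ 2 := by
    rw [hθ, inv_div, div_mul_eq_mul_div, div_le_iff₀ (by positivity)]
    linarith
  -- Young's inequality with weight θ, integrated from the square of (u − m) − θ(ξ − b).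
  have hcov : ∫ x, u x * ξ x ∂ν - m * b ≤ (1 / 2) * (θ⁻¹ * (T - m ^ 2) + θ * A) := by
    have hpt : ∀ x, u x * ξ x + (-b * u x + (-m * ξ x + m * b)) ≤
        (1 / 2) * θ⁻¹ * (u x ^ 2 + (-2 * m * u x + m ^ 2)) + (1 / 2) * θ * (ξ x - b) ^ 2 := fun x => by
      have h4 : 0 ≤ θ⁻¹ * ((u x - m) - θ * (ξ x - b)) ^ 2 := by positivity
      have h5 : θ⁻¹ * ((u x - m) - θ * (ξ x - b)) ^ 2 =
          θ⁻¹ * (u x - m) ^ 2 - 2 * (u x - m) * (ξ x - b) + θ * (ξ x - b) ^ 2 := by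
        field_simp
        ring
      nlinarith
    have j1 : Integrable (fun x => -m * ξ x + m * b) ν :=
      (hξi.const_mul _).add (integrable_const _)
    have j2 : Integrable (fun x => -b * u x + (-m * ξ x + m * b)) ν := (iu.const_mul _).add j1
    have j3 : Integrable (fun x => -2 * m * u x + m ^ 2) ν :=
      (iu.const_mul _).add (integrable_const _)
    have j4 : Integrable (fun x => u x ^ 2 + (-2 * m * u x + m ^ 2)) ν := iu2.add j3
    have h6 := integral_mono (iuξ.add j2) ((j4.const_mul ((1 / 2) * θ⁻¹)).add
      (iξ2.const_mul ((1 / 2) * θ))) hpt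
    simp only [Pi.add_apply] at h6
    rw [integral_add iuξ j2, integral_add (iu.const_mul _) j1, integral_add (hξi.const_mul _)
      (integrable_const _), integral_add (j4.const_mul _) (iξ2.const_mul _), integral_const_mul,
      integral_const_mul, integral_const_mul, integral_const_mul, integral_add iu2 j3,
      integral_add (iu.const_mul _) (integrable_const _), integral_const_mul, integral_const_mul, ← hm, ← hT, ← hA,
      ← hb] at h6
    simp only [integral_const, probReal_univ, one_smul] at h6
    linarith
  nlinarith [sq_nonneg (m - b)]

/-- The logarithmic gradients to which this is applied are bounded but need not be constant off a
compact set. Test functions approximate them almost everywhere for the law of the interpolation. -/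
lemma score_pairing_le {ν : Measure (Euc n)} {lam : ℝ} (hlam : 0 < lam)
    (hν : ν ∈ poincareClass n lam) {w : Euc n → ℝ} (hw : Continuous w) {M : ℝ}
    (hM : ∀ x, |w x| ≤ M)
    {s c : ℝ} (hs : 0 < s) (hc : 0 < c) {ξ : Euc n → ℝ} (hξ : MemLp ξ 2 ν) :
    ∫ q, w (interp (s ^ 2) (s * c) q) * ξ q.1 ∂(ν.prod (gaussN n))
      - (1 / 2) * ∫ q, w (interp (s ^ 2) (s * c) q) ^ 2 ∂(ν.prod (gaussN n)) ≤
      (1 / 2) * (s ^ 2 / (s ^ 2 + lam * c ^ 2) * ∫ x, (ξ x - ∫ y, ξ y ∂ν) ^ 2 ∂ν +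
        (∫ y, ξ y ∂ν) ^ 2) := by
  have hp : IsProbabilityMeasure ν := hν.1
  have hξi : Integrable ξ ν := hξ.integrable (by simp)
  set Y := interp (n := n) (s ^ 2) (s * c) with hY
  have hYc : Continuous Y := continuous_interp _ _
  have : IsProbabilityMeasure ((ν.prod (gaussN n)).map Y) :=
    Measure.isProbabilityMeasure_map hYc.aemeasurable
  obtain ⟨h, h1, h2, h3, h4⟩ := exists_contDiff_seq_tendsto_ae ((ν.prod (gaussN n)).map Y)
    hw.aestronglyMeasurable (M := |M| + 1) (by positivity)
    (fun x => (hM x).trans ((le_abs_self _).trans (by linarith)))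
  have h5 := ae_of_ae_map hYc.aemeasurable h4
  have hcs : ∀ k, Continuous (h k) := fun k => (h1 k).continuous
  have t1 : Tendsto (fun k => ∫ q, h k (Y q) * ξ q.1 ∂(ν.prod (gaussN n))) atTop
      (𝓝 (∫ q, w (Y q) * ξ q.1 ∂(ν.prod (gaussN n)))) := by
    refine tendsto_integral_of_dominated_convergence (fun q => (|M| + 1) * |ξ q.1|)
      (fun k => ?_) ((hξi.abs.comp_fst (gaussN n)).const_mul _) (fun k => .of_forall fun q => ?_) ?_
    · have := hcs k
      exact (Continuous.aestronglyMeasurable (by fun_prop)).mul (hξi.comp_fst (gaussN n)).1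
    · rw [Real.norm_eq_abs, abs_mul]
      exact mul_le_mul_of_nonneg_right (h3 k _) (abs_nonneg _)
    · filter_upwards [h5] with q hq using hq.mul_const _
  have t2 : Tendsto (fun k => ∫ q, h k (Y q) ^ 2 ∂(ν.prod (gaussN n))) atTop
      (𝓝 (∫ q, w (Y q) ^ 2 ∂(ν.prod (gaussN n)))) := by
    refine tendsto_integral_of_dominated_convergence (fun q => (|M| + 1) ^ 2)
      (fun k => ?_) (integrable_const _) (fun k => .of_forall fun q => ?_) ?_
    · have := hcs k
      exact Continuous.aestronglyMeasurable (by fun_prop)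
    · exact sq_le_of_abs_le (h3 k _)
    · filter_upwards [h5] with q hq using hq.pow 2
  exact le_of_tendsto (t1.sub (t2.const_mul (1 / 2))) (.of_forall fun k =>
    score_pairing_le_of_hasCompactSupport hlam hν
      (IsConstOffCompact.of_hasCompactSupport (h1 k) (h2 k)) hs hc hξ)

/-! ### Integration by parts along the interpolation -/

/-- The functions `S i` are the components of the score of `ν` relative to the Gaussian measure. -/
def IsScore (ν : Measure (Euc n)) (S : Fin n → Euc n → ℝ) : Prop :=
  (∀ i, MemLp (S i) 2 ν) ∧
  ∀ (i : Fin n) (h : Euc n → ℝ), ContDiff ℝ ∞ h → ∀ C : ℝ, (∀ x, |h x| ≤ C) →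
    (∀ x, ‖fderiv ℝ h x‖ ≤ C) →
    ∫ x, x i * h x ∂ν = ∫ x, pderivAt i h x ∂ν + ∫ x, h x * S i x ∂ν

lemma integrable_coord_gaussN (i : Fin n) : Integrable (fun z : Euc n => z i) (gaussN n) := by
  have := (memLp_inner_gaussN (EuclideanSpace.single i (1 : ℝ))).integrable (by simp)
  simpa [EuclideanSpace.inner_single_left] using this

lemma integral_snd_mul_interp {ν : Measure (Euc n)} [IsProbabilityMeasure ν]
    {w : Euc n → ℝ} (hw : ContDiff ℝ ∞ w) {C : ℝ}
    (hC : ∀ x, |w x| ≤ C) (hC' : ∀ x, ‖fderiv ℝ w x‖ ≤ C) (i : Fin n) (a σ : ℝ) :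
    ∫ q, q.2 i * w (interp a σ q) ∂(ν.prod (gaussN n)) =
      σ * ∫ q, pderivAt i w (interp a σ q) ∂(ν.prod (gaussN n)) := by
  have hwc := hw.continuous
  have hpc := (contDiff_pderivAt hw i).continuous
  have i1 : Integrable (fun q : Euc n × Euc n => q.2 i * w (interp a σ q)) (ν.prod (gaussN n)) :=
    ((integrable_coord_gaussN i).comp_snd ν).mul_bdd (c := C)
      (Continuous.aestronglyMeasurable (by fun_prop)) (.of_forall fun q => hC _)
  have i2 : Integrable (fun q : Euc n × Euc n => pderivAt i w (interp a σ q))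
      (ν.prod (gaussN n)) :=
    integrable_of_continuous_bounded (by fun_prop)
      fun q => (abs_pderivAt_le i w _).trans (hC' _)
  rw [integral_prod _ i1, integral_prod _ i2, ← integral_const_mul]
  exact integral_congr_ae (.of_forall fun x => stein_affine hw hC hC' i (a • x) σ)

/-- The score identity in x with z frozen; the chain rule through x ↦ ax + σz supplies the factor a.
-/
lemma integral_fst_mul_interp {ν : Measure (Euc n)} [IsProbabilityMeasure ν]
    {S : Fin n → Euc n → ℝ} (hS : IsScore ν S) (hν : ∀ i, Integrable (fun x : Euc n => x i) ν)
    {w : Euc n → ℝ} (hw : ContDiff ℝ ∞ w) {C : ℝ}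
    (hC : ∀ x, |w x| ≤ C) (hC' : ∀ x, ‖fderiv ℝ w x‖ ≤ C) (i : Fin n) (a σ : ℝ) :
    ∫ q, q.1 i * w (interp a σ q) ∂(ν.prod (gaussN n)) =
      a * ∫ q, pderivAt i w (interp a σ q) ∂(ν.prod (gaussN n)) +
        ∫ q, w (interp a σ q) * S i q.1 ∂(ν.prod (gaussN n)) := by
  have hwc := hw.continuous
  have hC0 : 0 ≤ C := (abs_nonneg _).trans (hC 0)
  have hwd := hw.differentiable (by simp)
  have hpc := (contDiff_pderivAt hw i).continuous
  have hSi : Integrable (S i) ν := (hS.1 i).integrable (by simp)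
  have i1 : Integrable (fun q : Euc n × Euc n => q.1 i * w (interp a σ q)) (ν.prod (gaussN n)) :=
    ((hν i).comp_fst (gaussN n)).mul_bdd (c := C)
      (Continuous.aestronglyMeasurable (by fun_prop)) (.of_forall fun q => hC _)
  have i2 : Integrable (fun q : Euc n × Euc n => pderivAt i w (interp a σ q))
      (ν.prod (gaussN n)) :=
    integrable_of_continuous_bounded (by fun_prop)
      fun q => (abs_pderivAt_le i w _).trans (hC' _)
  have i3 : Integrable (fun q : Euc n × Euc n => w (interp a σ q) * S i q.1) (ν.prod (gaussN n)) :=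
    (hSi.comp_fst (gaussN n)).bdd_mul (c := C) (Continuous.aestronglyMeasurable (by fun_prop))
      (.of_forall fun q => hC _)
  have i4 : Integrable (fun q : Euc n × Euc n =>
      a * pderivAt i w (interp a σ q) + w (interp a σ q) * S i q.1) (ν.prod (gaussN n)) :=
    (i2.const_mul a).add i3
  rw [← integral_const_mul, ← integral_add (i2.const_mul a) i3, integral_prod_symm _ i1,
    integral_prod_symm _ i4]
  refine integral_congr_ae (.of_forall fun z => ?_)
  have h1 := hS.2 i (fun x => w (σ • z + a • x)) (hw.comp (by fun_prop)) (C * |a| + C)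
    (fun x => (hC _).trans (by nlinarith [mul_nonneg hC0 (abs_nonneg a)]))
    (fun x => (norm_fderiv_comp_affine_le hwd hC' _ a x).trans (by linarith))
  simp only [pderivAt_comp_affine hwd] at h1
  have e : ∀ x, interp a σ (x, z) = σ • z + a • x := fun x => add_comm _ _
  simp only [e]
  rw [h1, integral_add]
  · exact integrable_of_continuous_bounded (C := |a| * C) (by fun_prop) fun x => by
      rw [abs_mul]
      exact mul_le_mul_of_nonneg_left ((abs_pderivAt_le i w _).trans (hC' _)) (abs_nonneg _)
  · exact hSi.bdd_mul (c := C) (Continuous.aestronglyMeasurable (by fun_prop))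
      (.of_forall fun q => hC _)

/-! ### The logarithmic gradient of a Gaussian average -/

/-- The `i`-th component of `∇ log (gaussAvg σ F)`. -/
noncomputable def logGrad (F : Euc n → ℝ) (σ : ℝ) (i : Fin n) (y : Euc n) : ℝ :=
  gaussAvg σ (pderivAt i F) y / gaussAvg σ F y

section LogGrad

variable {F : Euc n → ℝ} {m : ℝ}

lemma IsConstOffCompact.gaussAvg_pos (hF : IsConstOffCompact F) (hm : 0 < m) (hmF : ∀ x, m ≤ F x)
    (σ : ℝ) (y : Euc n) : 0 < gaussAvg σ F y := by
  obtain ⟨C, hC⟩ := hF.exists_bound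
  exact hm.trans_le (le_gaussAvg hF.1.continuous hC hmF σ y)

lemma contDiff_logGrad (hF : IsConstOffCompact F) (hm : 0 < m) (hmF : ∀ x, m ≤ F x) (σ : ℝ)
    (i : Fin n) : ContDiff ℝ ∞ (logGrad F σ i) :=
  ((hF.pderivAt i).contDiff_gaussAvg σ).div (hF.contDiff_gaussAvg σ)
    fun y => (hF.gaussAvg_pos hm hmF σ y).ne'

/-- On the diagonal this reads ∂ᵢᵢP / P = ∂ᵢwᵢ + wᵢ², which turns the second-order term of the heat
flow into the square of the logarithmic gradient. -/
lemma pderivAt_logGrad (hF : IsConstOffCompact F) (hm : 0 < m) (hmF : ∀ x, m ≤ F x) (σ : ℝ)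
    (i j : Fin n) (y : Euc n) :
    pderivAt j (logGrad F σ i) y =
      gaussAvg σ (pderivAt j (pderivAt i F)) y / gaussAvg σ F y -
        logGrad F σ i y * logGrad F σ j y := by
  have hp := (hF.gaussAvg_pos hm hmF σ y).ne'
  have h1 := (contDiff_logGrad hF hm hmF σ i).differentiable (by simp) y
  have h2 := (hF.contDiff_gaussAvg σ).differentiable (by simp) y
  have h3 : gaussAvg σ (pderivAt i F) = fun y => logGrad F σ i y * gaussAvg σ F y := by
    ext y
    exact (div_mul_cancel₀ _ (hF.gaussAvg_pos hm hmF σ y).ne').symm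
  have h4 := (hF.pderivAt i).pderivAt_gaussAvg σ j y
  rw [h3, pderivAt, fderiv_fun_mul h1 h2] at h4
  have h5 := hF.pderivAt_gaussAvg σ j y
  simp only [add_apply, smul_apply, smul_eq_mul] at h4
  rw [← h4]
  change _ = (logGrad F σ i y * pderivAt j (gaussAvg σ F) y +
    gaussAvg σ F y * pderivAt j (logGrad F σ i) y) / _ - _ * (gaussAvg σ (pderivAt j F) y / _)
  rw [h5]
  field_simp
  ring

/-- The averages of the first and second derivatives of F inherit their sup bounds, and the
denominator stays above m, so the constant does not depend on σ. -/
lemma exists_bound_logGrad (hF : IsConstOffCompact F) (hm : 0 < m) (hmF : ∀ x, m ≤ F x)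
    (i : Fin n) : ∃ C, ∀ σ, (∀ y, |logGrad F σ i y| ≤ C) ∧ ∀ y, ‖fderiv ℝ (logGrad F σ i) y‖ ≤ C := by
  have hle : ∀ σ y, m ≤ gaussAvg σ F y := fun σ y => by
    obtain ⟨C, hC⟩ := hF.exists_bound
    exact le_gaussAvg hF.1.continuous hC hmF σ y
  have hdiv : ∀ (h : Euc n → ℝ) (D : ℝ), (∀ x, |h x| ≤ D) → ∀ σ y,
      |gaussAvg σ h y / gaussAvg σ F y| ≤ D / m := fun h D hD σ y => by
    rw [abs_div]
    exact div_le_div₀ ((abs_nonneg _).trans (hD 0)) (abs_gaussAvg_le hD σ y) hm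
      ((hle σ y).trans (le_abs_self _))
  choose D hD using fun j => (hF.pderivAt j).exists_bound
  choose B hB using fun j => ((hF.pderivAt i).pderivAt j).exists_bound
  have hD0 : ∀ j, 0 ≤ D j / m := fun j => div_nonneg ((abs_nonneg _).trans (hD j 0)) hm.le
  refine ⟨max (D i / m) (∑ j, (B j / m + D i / m * (D j / m))), fun σ =>
    ⟨fun y => (hdiv _ _ (hD i) σ y).trans (le_max_left _ _), fun y => ?_⟩⟩
  refine (norm_fderiv_le_sum _ _).trans (le_trans (Finset.sum_le_sum fun j _ => ?_)
    (le_max_right _ _))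
  rw [pderivAt_logGrad hF hm hmF]
  refine (abs_sub _ _).trans (add_le_add (hdiv _ _ (hB j) σ y) ?_)
  rw [abs_mul]
  exact mul_le_mul (hdiv _ _ (hD i) σ y) (hdiv _ _ (hD j) σ y) (abs_nonneg _) (hD0 i)

end LogGrad

/-! ### The derivative of the interpolated logarithm -/

/-- The interpolation at angle `α`. -/
noncomputable def angleInterp (α : ℝ) (q : Euc n × Euc n) : Euc n :=
  interp (Real.sin α ^ 2) (Real.sin α * Real.cos α) q

/-- The `i`-th component of the velocity of the interpolation at angle `α`. -/
noncomputable def angleVel (α : ℝ) (q : Euc n × Euc n) (i : Fin n) : ℝ :=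
  2 * (Real.sin α * Real.cos α) * q.1 i + (Real.cos α ^ 2 - Real.sin α ^ 2) * q.2 i

/-- The derivative in `α` of `gaussAvg (cos α) F (angleInterp α q)`. -/
noncomputable def avgVel (F : Euc n → ℝ) (α : ℝ) (q : Euc n × Euc n) : ℝ :=
  ∑ i, (angleVel α q i * gaussAvg (Real.cos α) (pderivAt i F) (angleInterp α q)
    - Real.sin α * Real.cos α *
      gaussAvg (Real.cos α) (pderivAt i (pderivAt i F)) (angleInterp α q))

@[fun_prop]
lemma continuous_angleInterp (α : ℝ) : Continuous (angleInterp (n := n) α) :=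
  continuous_interp _ _

/-- Moving the base point gives the first-order terms. Varying the width cos α gives −sin α E[zᵢ
∂ᵢF], which Stein's identity converts into second derivatives. The angle parametrization keeps all
coefficients smooth up to the endpoints. -/
lemma hasDerivAt_gaussAvg_angleInterp {F : Euc n → ℝ} (hF : IsConstOffCompact F)
    (q : Euc n × Euc n) (α : ℝ) :
    HasDerivAt (fun α => gaussAvg (Real.cos α) F (angleInterp α q)) (avgVel F α q) α := by
  obtain ⟨C, hC⟩ := hF.exists_bound
  obtain ⟨D, hD⟩ := hF.exists_bound_fderiv
  have hD0 : 0 ≤ D := (norm_nonneg _).trans (hD 0)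
  have hFc := hF.1.continuous
  have hfd : Continuous (fderiv ℝ F) := hF.1.continuous_fderiv (by simp)
  set V : ℝ → Euc n := fun α => (2 * (Real.sin α * Real.cos α)) • q.1 +
    (Real.cos α ^ 2 - Real.sin α ^ 2) • q.2 with hV
  have hY : ∀ α, HasDerivAt (fun α => angleInterp α q) (V α) α := fun α => by
    have h1 : HasDerivAt (fun α => Real.sin α ^ 2) (2 * (Real.sin α * Real.cos α)) α := by
      refine ((Real.hasDerivAt_sin α).fun_pow 2).congr_deriv ?_
      simp; ring
    have h2 : HasDerivAt (fun α => Real.sin α * Real.cos α) (Real.cos α ^ 2 - Real.sin α ^ 2) α :=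
      ((Real.hasDerivAt_sin α).fun_mul (Real.hasDerivAt_cos α)).congr_deriv (by ring)
    exact (h1.smul_const q.1).add (h2.smul_const q.2)
  have hsc : ∀ α, |2 * (Real.sin α * Real.cos α)| ≤ 2 := fun α => by
    rw [abs_mul, abs_mul, abs_two]
    have := mul_le_one₀ (Real.abs_sin_le_one α) (abs_nonneg _) (Real.abs_cos_le_one α)
    linarith
  have hcs : ∀ α, |Real.cos α ^ 2 - Real.sin α ^ 2| ≤ 2 := fun α => by
    rw [abs_le]
    constructor <;> nlinarith [Real.sin_sq_add_cos_sq α, sq_nonneg (Real.sin α),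
      sq_nonneg (Real.cos α)]
  have hVb : ∀ α, ‖V α‖ ≤ 2 * ‖q.1‖ + 2 * ‖q.2‖ := fun α => by
    refine (norm_add_le _ _).trans (add_le_add ?_ ?_) <;> rw [norm_smul]
    · exact mul_le_mul_of_nonneg_right (hsc α) (norm_nonneg _)
    · exact mul_le_mul_of_nonneg_right (hcs α) (norm_nonneg _)
  have key := (hasDerivAt_integral_of_dominated_loc_of_deriv_le (μ := gaussN n)
    (F := fun α z => F (angleInterp α q + Real.cos α • z))
    (F' := fun α z => fderiv ℝ F (angleInterp α q + Real.cos α • z) (V α + (-Real.sin α) • z))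
    (bound := fun z => D * (2 * ‖q.1‖ + 2 * ‖q.2‖) + D * ‖z‖) (x₀ := α) Filter.univ_mem
    (.of_forall fun α => Continuous.aestronglyMeasurable (by fun_prop))
    (integrable_of_continuous_bounded (by fun_prop) fun z => hC _)
    (Continuous.aestronglyMeasurable (by fun_prop))
    (.of_forall fun z α _ => by
      refine ((fderiv ℝ F _).le_opNorm _).trans ?_
      rw [← mul_add]
      refine mul_le_mul (hD _) ((norm_add_le _ _).trans (add_le_add (hVb α) ?_)) (norm_nonneg _) hD0
      rw [norm_smul, norm_neg]
      exact mul_le_of_le_one_left (norm_nonneg _) (Real.abs_sin_le_one α))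
    ((integrable_const _).add (integrable_norm_gaussN.const_mul D))
    (.of_forall fun z α _ => by
      have h3 := (hY α).add ((Real.hasDerivAt_cos α).smul_const z)
      exact (hF.1.differentiable (by simp) _).hasFDerivAt.comp_hasDerivAt α h3)).2
  refine key.congr_deriv ?_
  set y := angleInterp α q with hy
  have hpb : ∀ i x, |pderivAt i F x| ≤ D := fun i x => (abs_pderivAt_le i F x).trans (hD x)
  have hpc : ∀ i, Continuous (pderivAt i F) := fun i => (contDiff_pderivAt hF.1 i).continuous
  have i1 : ∀ i, Integrable (fun z => pderivAt i F (y + Real.cos α • z)) (gaussN n) := fun i => by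
    have := hpc i
    exact integrable_of_continuous_bounded (by fun_prop) fun z => hpb i _
  have i2 : ∀ i, Integrable (fun z => z i * pderivAt i F (y + Real.cos α • z)) (gaussN n) :=
    fun i => by
      have := hpc i
      exact (integrable_coord_gaussN i).mul_bdd (c := D)
        (Continuous.aestronglyMeasurable (by fun_prop)) (.of_forall fun z => hpb i _)
  have e1 : ∀ z, fderiv ℝ F (y + Real.cos α • z) (V α + (-Real.sin α) • z) =
      ∑ i, (angleVel α q i * pderivAt i F (y + Real.cos α • z) -
        Real.sin α * (z i * pderivAt i F (y + Real.cos α • z))) := fun z => by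
    rw [fderiv_apply_eq_sum]
    refine Finset.sum_congr rfl fun i _ => ?_
    simp [hV, angleVel]
    ring
  simp_rw [e1]
  have i3 : ∀ i, Integrable (fun z => angleVel α q i * pderivAt i F (y + Real.cos α • z) -
      Real.sin α * (z i * pderivAt i F (y + Real.cos α • z))) (gaussN n) := fun i =>
    ((i1 i).const_mul _).sub ((i2 i).const_mul _)
  rw [integral_finsetSum _ fun i _ => i3 i, avgVel]
  refine Finset.sum_congr rfl fun i _ => ?_
  obtain ⟨D₂, hD₂⟩ := (hF.pderivAt i).exists_bound_fderiv
  rw [integral_sub ((i1 i).const_mul _) ((i2 i).const_mul _), integral_const_mul,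
    integral_const_mul, stein_affine (contDiff_pderivAt hF.1 i) (C := max D D₂)
    (fun x => (hpb i x).trans (le_max_left _ _)) (fun x => (hD₂ x).trans (le_max_right _ _)),
    ← mul_assoc]
  rfl

/-- The interpolated functional `∫ log (gaussAvg (cos α) F) ∘ angleInterp α`. -/
noncomputable def logFunctional (ν : Measure (Euc n)) (F : Euc n → ℝ) (α : ℝ) : ℝ :=
  ∫ q, Real.log (gaussAvg (Real.cos α) F (angleInterp α q)) ∂(ν.prod (gaussN n))

lemma hasDerivAt_logFunctional {ν : Measure (Euc n)} [IsProbabilityMeasure ν]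
    (hν : ∀ i, Integrable (fun x : Euc n => x i) ν) {F : Euc n → ℝ} {m : ℝ}
    (hF : IsConstOffCompact F) (hm : 0 < m) (hmF : ∀ x, m ≤ F x) (α : ℝ) :
    HasDerivAt (logFunctional ν F)
      (∫ q, avgVel F α q / gaussAvg (Real.cos α) F (angleInterp α q) ∂(ν.prod (gaussN n))) α := by
  obtain ⟨C, hC⟩ := hF.exists_bound
  have hFc := hF.1.continuous
  have hpos := hF.gaussAvg_pos hm hmF
  have hle : ∀ σ y, m ≤ gaussAvg σ F y := fun σ y => le_gaussAvg hFc hC hmF σ y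
  have hac : ∀ σ, Continuous (gaussAvg σ F) := fun σ => (hF.contDiff_gaussAvg σ).continuous
  choose D hD using fun j => (hF.pderivAt j).exists_bound
  choose B hB using fun j => ((hF.pderivAt j).pderivAt j).exists_bound
  have hc1 : ∀ α, Continuous fun q => gaussAvg (Real.cos α) F (angleInterp (n := n) α q) :=
    fun α => (hac _).comp (by fun_prop)
  have hlogc : ∀ α, Continuous fun q =>
      Real.log (gaussAvg (Real.cos α) F (angleInterp (n := n) α q)) :=
    fun α => (hc1 α).log fun q => (hpos _ _).ne'
  have hvc : Continuous (avgVel F α) := by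
    unfold avgVel angleVel
    refine continuous_finsetSum _ fun i _ => ?_
    have h1 : Continuous fun q => gaussAvg (Real.cos α) (pderivAt i F) (angleInterp (n := n) α q) :=
      ((hF.pderivAt i).contDiff_gaussAvg _).continuous.comp (by fun_prop)
    have h2 : Continuous fun q => gaussAvg (Real.cos α) (pderivAt i (pderivAt i F))
        (angleInterp (n := n) α q) :=
      (((hF.pderivAt i).pderivAt i).contDiff_gaussAvg _).continuous.comp (by fun_prop)
    fun_prop
  have hbd : ∀ (q : Euc n × Euc n) α, |avgVel F α q| ≤
      ∑ i, ((2 * |q.1 i| + 2 * |q.2 i|) * D i + B i) := fun q α => by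
    refine (Finset.abs_sum_le_sum_abs _ _).trans (Finset.sum_le_sum fun i _ => ?_)
    have hs := Real.abs_sin_le_one α
    have hc := Real.abs_cos_le_one α
    have hsc : |Real.sin α * Real.cos α| ≤ 1 := by
      rw [abs_mul]; exact mul_le_one₀ hs (abs_nonneg _) hc
    have hcs : |Real.cos α ^ 2 - Real.sin α ^ 2| ≤ 2 := by
      rw [abs_le]
      constructor <;> nlinarith [Real.sin_sq_add_cos_sq α, sq_nonneg (Real.sin α),
        sq_nonneg (Real.cos α)]
    have hv : |angleVel α q i| ≤ 2 * |q.1 i| + 2 * |q.2 i| := by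
      refine (abs_add_le _ _).trans (add_le_add ?_ ?_)
      · rw [abs_mul, abs_mul, abs_two]
        exact mul_le_mul_of_nonneg_right (by linarith) (abs_nonneg _)
      · rw [abs_mul]
        exact mul_le_mul_of_nonneg_right hcs (abs_nonneg _)
    refine (abs_sub _ _).trans (add_le_add ?_ ?_)
    · rw [abs_mul]
      exact mul_le_mul hv (abs_gaussAvg_le (hD i) _ _) (abs_nonneg _) (by positivity)
    · rw [abs_mul]
      calc _ ≤ 1 * B i := mul_le_mul hsc (abs_gaussAvg_le (hB i) _ _) (abs_nonneg _) zero_le_one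
        _ = B i := one_mul _
  refine (hasDerivAt_integral_of_dominated_loc_of_deriv_le (μ := ν.prod (gaussN n))
    (F := fun α q => Real.log (gaussAvg (Real.cos α) F (angleInterp α q)))
    (F' := fun α q => avgVel F α q / gaussAvg (Real.cos α) F (angleInterp α q))
    (bound := fun q => (∑ i, ((2 * |q.1 i| + 2 * |q.2 i|) * D i + B i)) / m) (x₀ := α)
    Filter.univ_mem (.of_forall fun α => (hlogc α).aestronglyMeasurable)
    ?_ ?_ (.of_forall fun q α _ => ?_) ?_ (.of_forall fun q α _ => ?_)).2
  · refine integrable_of_continuous_bounded (hlogc α) (C := |Real.log m| + |Real.log C|) fun q => ?_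
    have h1 := Real.log_le_log hm (hle (Real.cos α) (angleInterp α q))
    have h2 := Real.log_le_log (hpos (Real.cos α) (angleInterp α q))
      ((le_abs_self _).trans (abs_gaussAvg_le hC (Real.cos α) (angleInterp α q)))
    rw [abs_le]
    constructor
    · linarith [neg_abs_le (Real.log m), abs_nonneg (Real.log C)]
    · linarith [le_abs_self (Real.log C), abs_nonneg (Real.log m)]
  · exact (hvc.div (hc1 α) fun q => (hpos _ _).ne').aestronglyMeasurable
  · rw [Real.norm_eq_abs, abs_div]
    exact div_le_div₀ ((abs_nonneg _).trans (hbd q α)) (hbd q α) hm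
      ((hle _ _).trans (le_abs_self _))
  · refine Integrable.div_const (integrable_finsetSum _ fun i _ => ?_) m
    exact (((((hν i).abs.comp_fst (gaussN n)).const_mul 2).add
      (((integrable_coord_gaussN i).abs.comp_snd ν).const_mul 2)).mul_const _).add
      (integrable_const _)
  · exact (hasDerivAt_gaussAvg_angleInterp hF q α).log (hpos _ _).ne'

/-- The velocity divided by the average is a combination of xᵢwᵢ, zᵢwᵢ, ∂ᵢwᵢ and wᵢ². After both
integrations by parts the coefficient of ∂ᵢwᵢ is sc(2s² + (c² − s²) − 1) = 0, so only the score
pairing and the square remain. -/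
lemma integral_avgVel_div {ν : Measure (Euc n)} [IsProbabilityMeasure ν]
    (hν : ∀ i, Integrable (fun x : Euc n => x i) ν) {S : Fin n → Euc n → ℝ} (hS : IsScore ν S)
    {F : Euc n → ℝ} {m : ℝ}
    (hF : IsConstOffCompact F) (hm : 0 < m) (hmF : ∀ x, m ≤ F x) (α : ℝ) :
    ∫ q, avgVel F α q / gaussAvg (Real.cos α) F (angleInterp α q) ∂(ν.prod (gaussN n)) =
      ∑ i, 2 * (Real.sin α * Real.cos α) *
        (∫ q, logGrad F (Real.cos α) i (angleInterp α q) * S i q.1 ∂(ν.prod (gaussN n)) -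
          (1 / 2) * ∫ q, logGrad F (Real.cos α) i (angleInterp α q) ^ 2 ∂(ν.prod (gaussN n))) := by
  set s := Real.sin α with hs
  set c := Real.cos α with hc
  set w := logGrad F c with hw
  have hwb : ∀ i, ∃ C, (∀ y, |w i y| ≤ C) ∧ ∀ y, ‖fderiv ℝ (w i) y‖ ≤ C := fun i => by
    obtain ⟨C, hC⟩ := exists_bound_logGrad hF hm hmF i
    exact ⟨C, hC c⟩
  choose C hC hC' using hwb
  have hws : ∀ i, ContDiff ℝ ∞ (w i) := contDiff_logGrad hF hm hmF c
  have e1 : ∀ q : Euc n × Euc n, avgVel F α q / gaussAvg c F (angleInterp α q) =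
      ∑ i, (2 * (s * c) * (q.1 i * w i (angleInterp α q)) +
        ((c ^ 2 - s ^ 2) * (q.2 i * w i (angleInterp α q)) -
        (s * c * pderivAt i (w i) (angleInterp α q) + s * c * w i (angleInterp α q) ^ 2))) := by
    intro q
    rw [avgVel, Finset.sum_div]
    refine Finset.sum_congr rfl fun i _ => ?_
    rw [hw, pderivAt_logGrad hF hm hmF, angleVel]
    have := (hF.gaussAvg_pos hm hmF c (angleInterp α q)).ne'
    simp only [logGrad, ← hs, ← hc]
    field_simp
    ring
  simp_rw [e1]
  have hY : angleInterp (n := n) α = interp (s ^ 2) (s * c) := rfl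
  simp only [hY]
  have i1 : ∀ i, Integrable (fun q : Euc n × Euc n => q.1 i * w i (interp (s ^ 2) (s * c) q))
      (ν.prod (gaussN n)) := fun i => by
    have := (hws i).continuous
    exact ((hν i).comp_fst (gaussN n)).mul_bdd (c := C i)
      (Continuous.aestronglyMeasurable (by fun_prop)) (.of_forall fun q => hC i _)
  have i2 : ∀ i, Integrable (fun q : Euc n × Euc n => q.2 i * w i (interp (s ^ 2) (s * c) q))
      (ν.prod (gaussN n)) := fun i => by
    have := (hws i).continuous
    exact ((integrable_coord_gaussN i).comp_snd ν).mul_bdd (c := C i)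
      (Continuous.aestronglyMeasurable (by fun_prop)) (.of_forall fun q => hC i _)
  have i3 : ∀ i, Integrable (fun q : Euc n × Euc n => pderivAt i (w i) (interp (s ^ 2) (s * c) q))
      (ν.prod (gaussN n)) := fun i => by
    have := (contDiff_pderivAt (hws i) i).continuous
    exact integrable_of_continuous_bounded (by fun_prop)
      fun q => (abs_pderivAt_le i _ _).trans (hC' i _)
  have i4 : ∀ i, Integrable (fun q : Euc n × Euc n => w i (interp (s ^ 2) (s * c) q) ^ 2)
      (ν.prod (gaussN n)) := fun i => by
    have := (hws i).continuous
    exact integrable_of_continuous_bounded (by fun_prop) fun q => sq_le_of_abs_le (hC i _)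
  have i34 : ∀ i, Integrable (fun q : Euc n × Euc n =>
      s * c * pderivAt i (w i) (interp (s ^ 2) (s * c) q) +
      s * c * w i (interp (s ^ 2) (s * c) q) ^ 2) (ν.prod (gaussN n)) := fun i =>
    ((i3 i).const_mul _).add ((i4 i).const_mul _)
  have i234 : ∀ i, Integrable (fun q : Euc n × Euc n =>
      (c ^ 2 - s ^ 2) * (q.2 i * w i (interp (s ^ 2) (s * c) q)) -
      (s * c * pderivAt i (w i) (interp (s ^ 2) (s * c) q) +
      s * c * w i (interp (s ^ 2) (s * c) q) ^ 2)) (ν.prod (gaussN n)) := fun i =>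
    ((i2 i).const_mul _).sub (i34 i)
  have i1234 : ∀ i, Integrable (fun q : Euc n × Euc n =>
      2 * (s * c) * (q.1 i * w i (interp (s ^ 2) (s * c) q)) +
      ((c ^ 2 - s ^ 2) * (q.2 i * w i (interp (s ^ 2) (s * c) q)) -
      (s * c * pderivAt i (w i) (interp (s ^ 2) (s * c) q) +
      s * c * w i (interp (s ^ 2) (s * c) q) ^ 2))) (ν.prod (gaussN n)) := fun i =>
    ((i1 i).const_mul _).add (i234 i)
  rw [integral_finsetSum _ fun i _ => i1234 i]
  refine Finset.sum_congr rfl fun i _ => ?_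
  rw [integral_add ((i1 i).const_mul _) (i234 i), integral_sub ((i2 i).const_mul _) (i34 i),
    integral_add ((i3 i).const_mul _) ((i4 i).const_mul _), integral_const_mul, integral_const_mul,
    integral_const_mul, integral_const_mul,
    integral_snd_mul_interp (hws i) (hC i) (hC' i) i,
    integral_fst_mul_interp hS hν (hws i) (hC i) (hC' i) i]
  have hsc : c ^ 2 = 1 - s ^ 2 := by rw [hs, hc, Real.cos_sq']
  rw [hsc]
  ring

/-! ### The entropy bound in dual form -/

/-- This identifies c(λ) as the integral over [0, 1] of the contraction factor u / (u + λ(1 − u)),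
where u stands for sin² α. -/
lemma exists_primitive_lsiConst {lam : ℝ} (hlam : 0 < lam) :
    ∃ k : ℝ → ℝ, (∀ u ∈ Set.Icc (0 : ℝ) 1, HasDerivAt k (u / (u + lam * (1 - u))) u) ∧
      k 1 - k 0 = lsiConst lam := by
  by_cases h1 : lam = 1
  · refine ⟨fun u => u ^ 2 / 2, fun u _ => ?_, by simp [lsiConst, h1]⟩
    refine ((hasDerivAt_pow 2 u).div_const 2).congr_deriv ?_
    simp [h1]
  · have h2 : (1 - lam) ≠ 0 := sub_ne_zero.2 (Ne.symm h1)
    -- Partial fractions: u / (λ + (1−λ)u) = 1/(1−λ) − (λ/(1−λ)) / (λ + (1−λ)u).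
    refine ⟨fun u => u / (1 - lam) - lam / (1 - lam) ^ 2 * Real.log (lam + (1 - lam) * u),
      fun u hu => ?_, ?_⟩
    · have hpos : 0 < u + lam * (1 - u) := by
        rcases hu.1.eq_or_lt with h | h
        · rw [← h]; simpa using hlam
        · have := mul_nonneg hlam.le (sub_nonneg.2 hu.2)
          linarith
      have hpos' : lam + (1 - lam) * u ≠ 0 := by
        have : lam + (1 - lam) * u = u + lam * (1 - u) := by ring
        rw [this]; exact hpos.ne'
      have h3 := ((((hasDerivAt_id u).const_mul (1 - lam)).const_add lam).log hpos').const_mul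
        (lam / (1 - lam) ^ 2)
      refine (((hasDerivAt_id u).div_const (1 - lam)).sub h3).congr_deriv ?_
      have h4 : u + lam * (1 - u) = lam + (1 - lam) * u := by ring
      rw [h4]
      simp only [id_eq]
      field_simp
      ring
    · simp only [lsiConst, h1, if_false]
      simp
      field_simp

/-- The left side is the increment of `logFunctional` from 0 to π/2. Its derivative is dominated by
that of ½ (B sin² α + A k(sin² α)), with k the primitive above, whose increment is the right side.
-/
lemma integral_log_sub_log_integral_le_of_isConstOffCompact {ν : Measure (Euc n)} {lam : ℝ}
    (hlam : 0 < lam) (hν : ν ∈ poincareClass n lam) {S : Fin n → Euc n → ℝ} (hS : IsScore ν S)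
    {F : Euc n → ℝ} {m : ℝ} (hF : IsConstOffCompact F) (hm : 0 < m) (hmF : ∀ x, m ≤ F x) :
    ∫ x, Real.log (F x) ∂ν - Real.log (∫ x, F x ∂(gaussN n)) ≤
      (1 / 2) * (∑ i, (∫ y, S i y ∂ν) ^ 2 +
        lsiConst lam * ∑ i, ∫ x, (S i x - ∫ y, S i y ∂ν) ^ 2 ∂ν) := by
  have hp : IsProbabilityMeasure ν := hν.1
  set B := ∑ i, (∫ y, S i y ∂ν) ^ 2 with hB
  set A := ∑ i, ∫ x, (S i x - ∫ y, S i y ∂ν) ^ 2 ∂ν with hA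
  obtain ⟨k, hk1, hk2⟩ := exists_primitive_lsiConst hlam
  have hco := fun i => integrable_coord_of_poincare hlam hν i
  have hder := hasDerivAt_logFunctional hco hF hm hmF
  have hsin : ∀ α, Real.sin α ^ 2 ∈ Set.Icc (0 : ℝ) 1 := fun α =>
    ⟨sq_nonneg _, Real.sin_sq_le_one α⟩
  have hkder : ∀ α, HasDerivAt (fun α => (1 / 2) * (B * Real.sin α ^ 2 + A * k (Real.sin α ^ 2)))
      (Real.sin α * Real.cos α * (B + A * (Real.sin α ^ 2 /
        (Real.sin α ^ 2 + lam * Real.cos α ^ 2)))) α := fun α => by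
    have h1 : HasDerivAt (fun α => Real.sin α ^ 2) (2 * (Real.sin α * Real.cos α)) α := by
      refine ((Real.hasDerivAt_sin α).fun_pow 2).congr_deriv ?_
      simp; ring
    have h2 := (hk1 _ (hsin α)).comp α h1
    refine (((h1.const_mul B).add (h2.const_mul A)).const_mul (1 / 2)).congr_deriv ?_
    rw [Real.cos_sq']
    ring
  have hmono : MonotoneOn (fun α => (1 / 2) * (B * Real.sin α ^ 2 + A * k (Real.sin α ^ 2)) -
      logFunctional ν F α) (Set.Icc 0 (Real.pi / 2)) := by
    refine monotoneOn_of_hasDerivWithinAt_nonneg (convex_Icc _ _)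
      (fun α _ => ((hkder α).sub (hder α)).continuousAt.continuousWithinAt)
      (fun α _ => ((hkder α).sub (hder α)).hasDerivWithinAt) (fun α hα => ?_)
    rw [interior_Icc] at hα
    have hs : 0 < Real.sin α := Real.sin_pos_of_pos_of_lt_pi hα.1 (by linarith [hα.2, Real.pi_pos])
    have hc : 0 < Real.cos α := Real.cos_pos_of_mem_Ioo ⟨by linarith [hα.1, Real.pi_pos], hα.2⟩
    rw [sub_nonneg, integral_avgVel_div hco hS hF hm hmF, hA, hB, mul_comm (Finset.sum _ _),
      Finset.mul_sum, ← Finset.sum_add_distrib, Finset.mul_sum]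
    refine Finset.sum_le_sum fun i _ => ?_
    obtain ⟨C, hC⟩ := exists_bound_logGrad hF hm hmF i
    have h3 := score_pairing_le hlam hν (contDiff_logGrad hF hm hmF (Real.cos α) i).continuous
      (hC (Real.cos α)).1 hs hc (hS.1 i)
    have h4 := mul_le_mul_of_nonneg_left h3 (by positivity : 0 ≤ 2 * (Real.sin α * Real.cos α))
    refine h4.trans (le_of_eq ?_)
    ring
  have h0 := hmono (Set.left_mem_Icc.2 (by positivity)) (Set.right_mem_Icc.2 (by positivity))
    (by positivity)
  have e1 : logFunctional ν F (Real.pi / 2) = ∫ x, Real.log (F x) ∂ν := by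
    simp only [logFunctional, angleInterp, interp, Real.cos_pi_div_two, Real.sin_pi_div_two,
      gaussAvg_zero, mul_zero, zero_smul, add_zero, one_pow, one_smul]
    rw [integral_fun_fst (fun x => Real.log (F x))]
    simp
  have e0 : logFunctional ν F 0 = Real.log (∫ x, F x ∂(gaussN n)) := by
    simp [logFunctional, angleInterp, interp, gaussAvg]
  simp only [e1, e0, Real.sin_pi_div_two, Real.sin_zero] at h0
  norm_num at h0
  rw [← hk2]
  linarith

/-- Uniformly bounded test functions h converge to g almost everywhere for γ, hence also for ν by
absolute continuity; each exp h equals 1 off a compact set and is bounded below. -/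
lemma integral_sub_log_integral_exp_le {ν : Measure (Euc n)} {lam : ℝ}
    (hlam : 0 < lam) (hν : ν ∈ poincareClass n lam) (hνγ : ν ≪ gaussN n)
    {S : Fin n → Euc n → ℝ} (hS : IsScore ν S)
    {g : Euc n → ℝ} (hg : Measurable g) {M : ℝ} (hM : ∀ x, |g x| ≤ M) :
    ∫ x, g x ∂ν - Real.log (∫ x, Real.exp (g x) ∂(gaussN n)) ≤
      (1 / 2) * (∑ i, (∫ y, S i y ∂ν) ^ 2 +
        lsiConst lam * ∑ i, ∫ x, (S i x - ∫ y, S i y ∂ν) ^ 2 ∂ν) := by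
  have hp : IsProbabilityMeasure ν := hν.1
  obtain ⟨h, h1, h2, h3, h4⟩ := exists_contDiff_seq_tendsto_ae (gaussN n)
    hg.aestronglyMeasurable (M := |M| + 1) (by positivity)
    (fun x => (hM x).trans ((le_abs_self _).trans (by linarith)))
  have hcs : ∀ k, Continuous (h k) := fun k => (h1 k).continuous
  have t1 : Tendsto (fun k => ∫ x, h k x ∂ν) atTop (𝓝 (∫ x, g x ∂ν)) :=
    tendsto_integral_of_dominated_convergence (fun _ => |M| + 1)
      (fun k => (hcs k).aestronglyMeasurable) (integrable_const _)
      (fun k => .of_forall fun x => h3 k x) (hνγ.ae_le h4)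
  have t2 : Tendsto (fun k => ∫ x, Real.exp (h k x) ∂(gaussN n)) atTop
      (𝓝 (∫ x, Real.exp (g x) ∂(gaussN n))) := by
    refine tendsto_integral_of_dominated_convergence (fun _ => Real.exp (|M| + 1))
      (fun k => (hcs k).rexp.aestronglyMeasurable) (integrable_const _)
      (fun k => .of_forall fun x => ?_) ?_
    · rw [Real.norm_of_nonneg (Real.exp_pos _).le]
      exact Real.exp_le_exp.2 ((le_abs_self _).trans (h3 k x))
    · filter_upwards [h4] with x hx using (Real.continuous_exp.tendsto _).comp hx
  have hpos : 0 < ∫ x, Real.exp (g x) ∂(gaussN n) := by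
    refine integral_exp_pos ?_
    refine Integrable.of_bound hg.exp.aestronglyMeasurable (Real.exp M) (.of_forall fun x => ?_)
    rw [Real.norm_of_nonneg (Real.exp_pos _).le]
    exact Real.exp_le_exp.2 ((le_abs_self _).trans (hM x))
  refine le_of_tendsto (t1.sub (t2.log hpos.ne')) (.of_forall fun k => ?_)
  have hF : IsConstOffCompact fun x => Real.exp (h k x) :=
    ⟨(h1 k).exp, 1, (h2 k).comp_left (g := fun y => Real.exp y - 1) (by simp)⟩
  have := integral_log_sub_log_integral_le_of_isConstOffCompact hlam hν hS hF
    (Real.exp_pos (-(|M| + 1))) (fun x => Real.exp_le_exp.2 (abs_le.1 (h3 k x)).1)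
  simpa only [Real.log_exp] using this

/-- Passage from the dual form to the entropy. -/
lemma integral_mul_log_le_of_dual {f : Euc n → ℝ} (hfm : Measurable f) (hf : ∀ x, 0 ≤ f x)
    (hfi : Integrable f (gaussN n)) (hf1 : ∫ x, f x ∂(gaussN n) = 1)
    (hH : Integrable (fun x => f x * Real.log (f x)) (gaussN n)) {K : ℝ}
    (hK : ∀ g : Euc n → ℝ, Measurable g → (∃ M, ∀ x, |g x| ≤ M) →
      ∫ x, f x * g x ∂(gaussN n) - Real.log (∫ x, Real.exp (g x) ∂(gaussN n)) ≤ K) :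
    ∫ x, f x * Real.log (f x) ∂(gaussN n) ≤ K := by
  -- The optimal g would be log f; clamping f between 1/(k+1) and k+1 makes it bounded.
  set cl : ℕ → Euc n → ℝ := fun k x => max ((k : ℝ) + 1)⁻¹ (min (f x) ((k : ℝ) + 1)) with hcl
  have hk1 : ∀ k : ℕ, (1 : ℝ) ≤ (k : ℝ) + 1 := fun k => by
    linarith [(Nat.cast_nonneg k : (0 : ℝ) ≤ k)]
  have hki : ∀ k : ℕ, ((k : ℝ) + 1)⁻¹ ≤ 1 := fun k => inv_le_one_of_one_le₀ (hk1 k)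
  have hkp : ∀ k : ℕ, 0 < ((k : ℝ) + 1)⁻¹ := fun k => by positivity
  have hclp : ∀ k x, 0 < cl k x := fun k x => lt_max_of_lt_left (hkp k)
  have hclm : ∀ k, Measurable (cl k) := fun k =>
    measurable_const.max (hfm.min measurable_const)
  have hclu : ∀ k x, cl k x ≤ (k : ℝ) + 1 := fun k x =>
    max_le ((hki k).trans (hk1 k)) (min_le_right _ _)
  have hlogb : ∀ k x, |Real.log (cl k x)| ≤ Real.log ((k : ℝ) + 1) := fun k x => by
    rw [abs_le, ← Real.log_inv]
    exact ⟨Real.log_le_log (hkp k) (le_max_left _ _), Real.log_le_log (hclp k x) (hclu k x)⟩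
  have hev : ∀ x, 0 < f x → ∀ᶠ k in atTop, cl k x = f x := fun x hx => by
    obtain ⟨N, hN⟩ := exists_nat_gt (max (f x) (f x)⁻¹)
    filter_upwards [eventually_ge_atTop N] with k hk
    have h1 : (N : ℝ) ≤ k := by exact_mod_cast hk
    have h2 : f x ≤ k + 1 := by linarith [le_max_left (f x) (f x)⁻¹]
    have h3 : ((k : ℝ) + 1)⁻¹ ≤ f x := by
      rw [inv_le_comm₀ (by positivity) hx]
      linarith [le_max_right (f x) (f x)⁻¹]
    rw [hcl]
    simp only [min_eq_left h2, max_eq_right h3]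
  have t1 : Tendsto (fun k => ∫ x, f x * Real.log (cl k x) ∂(gaussN n)) atTop
      (𝓝 (∫ x, f x * Real.log (f x) ∂(gaussN n))) := by
    refine tendsto_integral_of_dominated_convergence (fun x => |f x * Real.log (f x)|)
      (fun k => (hfm.mul (hclm k).log).aestronglyMeasurable) hH.abs
      (fun k => .of_forall fun x => ?_) (.of_forall fun x => ?_)
    -- Clamping moves f towards 1 without crossing it, so |log| decreases wherever f > 0; where f =
    -- 0 both products vanish.
    · rw [Real.norm_eq_abs, abs_mul, abs_mul]
      refine (hf x).eq_or_lt.elim (fun h => by simp [← h]) fun h0 => ?_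
      refine mul_le_mul_of_nonneg_left ?_ (abs_nonneg _)
      rcases le_total (f x) 1 with h1 | h1
      · have h2 : cl k x ≤ 1 := max_le (hki k) ((min_le_left _ _).trans h1)
        have h3 : f x ≤ cl k x :=
          le_max_of_le_right (le_min le_rfl (h1.trans (hk1 k)))
        rw [abs_of_nonpos (Real.log_nonpos (hclp k x).le h2),
          abs_of_nonpos (Real.log_nonpos h0.le h1)]
        exact neg_le_neg (Real.log_le_log h0 h3)
      · have h2 : 1 ≤ cl k x := le_max_of_le_right (le_min h1 (hk1 k))
        have h3 : cl k x ≤ f x := max_le ((hki k).trans h1) (min_le_left _ _)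
        rw [abs_of_nonneg (Real.log_nonneg h2), abs_of_nonneg (Real.log_nonneg h1)]
        exact Real.log_le_log (hclp k x) h3
    · refine (hf x).eq_or_lt.elim (fun h => by simp [← h]) fun h0 => ?_
      exact tendsto_const_nhds.congr' ((hev x h0).mono fun k hk => by simp only [hk])
  have t2 : Tendsto (fun k => ∫ x, cl k x ∂(gaussN n)) atTop (𝓝 1) := by
    rw [← hf1]
    refine tendsto_integral_of_dominated_convergence (fun x => f x + 1)
      (fun k => (hclm k).aestronglyMeasurable) (hfi.add (integrable_const 1))
      (fun k => .of_forall fun x => ?_) (.of_forall fun x => ?_)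
    · rw [Real.norm_of_nonneg (hclp k x).le]
      exact max_le ((hki k).trans (by linarith [hf x])) ((min_le_left _ _).trans (by linarith))
    · refine (hf x).eq_or_lt.elim (fun h => ?_) fun h0 => ?_
      · have : ∀ k, cl k x = ((k : ℝ) + 1)⁻¹ := fun k => by
          rw [hcl]
          simp only [← h]
          rw [min_eq_left (by positivity), max_eq_left (hkp k).le]
        simp_rw [this, ← h]
        simpa using (tendsto_one_div_add_atTop_nhds_zero_nat (𝕜 := ℝ))
      · exact tendsto_const_nhds.congr' ((hev x h0).mono fun k hk => by simp only [hk])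
  have t3 := t1.sub (t2.log one_ne_zero)
  rw [Real.log_one, sub_zero] at t3
  refine le_of_tendsto t3 (.of_forall fun k => ?_)
  have := hK (fun x => Real.log (cl k x)) (hclm k).log ⟨_, hlogb k⟩
  simpa only [Real.exp_log (hclp k _)] using this

/-! ### The score of a measure with a weakly differentiable density -/

lemma integral_withDensity_ofReal {f : Euc n → ℝ} (hfm : Measurable f) (hf : ∀ x, 0 ≤ f x)
    (g : Euc n → ℝ) :
    ∫ x, g x ∂((gaussN n).withDensity fun x => ENNReal.ofReal (f x)) =
      ∫ x, f x * g x ∂(gaussN n) := by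
  rw [integral_withDensity_eq_integral_toReal_smul hfm.ennreal_ofReal (by simp)]
  simp [ENNReal.toReal_ofReal (hf _)]

lemma integrable_withDensity_ofReal_iff {E : Type*} [NormedAddCommGroup E] [NormedSpace ℝ E]
    {f : Euc n → ℝ} (hfm : Measurable f) (hf : ∀ x, 0 ≤ f x) {g : Euc n → E} :
    Integrable g ((gaussN n).withDensity fun x => ENNReal.ofReal (f x)) ↔
      Integrable (fun x => f x • g x) (gaussN n) := by
  rw [integrable_withDensity_iff_integrable_smul' hfm.ennreal_ofReal (by simp)]
  simp [ENNReal.toReal_ofReal (hf _)]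

lemma WeaklyDifferentiable.hasWeakGradient {f : Euc n → ℝ} (hf : WeaklyDifferentiable f) :
    HasWeakGradient f (weakGradient f) := by
  rw [weakGradient, dif_pos hf]
  exact hf.choose_spec

lemma mul_norm_gradientLog_sq {f : Euc n → ℝ} (x : Euc n) :
    f x * ‖gradientLog f x‖ ^ 2 = fisherIntegrand f x := by
  rw [gradientLog, fisherIntegrand, norm_smul, mul_pow, norm_inv, Real.norm_eq_abs, inv_pow, sq_abs]
  -- Where f = 0, both sides are 0 by the convention for division by zero.
  by_cases h : f x = 0
  · simp [h]
  · field_simp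

section Score

variable {f : Euc n → ℝ} {ν : Measure (Euc n)}

lemma memLp_gradientLog (hfm : Measurable f) (hf : ∀ x, 0 ≤ f x) (hfd : WeaklyDifferentiable f)
    (hν : ν = (gaussN n).withDensity fun x => ENNReal.ofReal (f x))
    (hI : Integrable (fisherIntegrand f) (gaussN n)) : MemLp (gradientLog f) 2 ν := by
  have hG := hfd.hasWeakGradient.2.1.aestronglyMeasurable
  have hac : gaussN n ≪ volume := fun s hs => by
    rw [stdGaussian_eq_withDensity]
    exact withDensity_absolutelyContinuous _ _ hs
  have hνγ : ν ≪ gaussN n := by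
    rw [hν]; exact withDensity_absolutelyContinuous _ _
  have hm : AEStronglyMeasurable (gradientLog f) ν :=
    hfm.inv.aestronglyMeasurable.smul ((hG.mono_ac hac).mono_ac hνγ)
  rw [memLp_two_iff_integrable_sq_norm hm, hν, integrable_withDensity_ofReal_iff hfm hf]
  simpa only [smul_eq_mul, mul_norm_gradientLog_sq] using hI

/-- Gaussian integration by parts for f, rewritten under ν = f γ. Finite Fisher information puts ∇
log f in L²(ν), which makes ∇f integrable for γ. -/
lemma isScore_gradientLog (hfm : Measurable f) (hf : ∀ x, 0 ≤ f x) (hfd : WeaklyDifferentiable f)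
    (hν : ν = (gaussN n).withDensity fun x => ENNReal.ofReal (f x)) [IsProbabilityMeasure ν]
    (hx : Integrable (fun x : Euc n => x) ν)
    (hI : Integrable (fisherIntegrand f) (gaussN n)) :
    IsScore ν fun i x => gradientLog f x i := by
  have hL := memLp_gradientLog hfm hf hfd hν hI
  have hLi : ∀ i, MemLp (fun x => gradientLog f x i) 2 ν := fun i => hL.eval_piLp i
  have hw := hfd.hasWeakGradient
  -- On {f = 0} the left side is 0, so the vanishing of ∇f there is essential.
  have hz : ∀ᵐ x ∂(gaussN n), f x • gradientLog f x = weakGradient f x := by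
    rw [gaussN_ae_iff]
    filter_upwards [hw.eq_zero_of_eq_zero hfm hf] with x hx0
    by_cases h : f x = 0
    · rw [hx0 h, h, zero_smul]
    · rw [gradientLog, smul_smul, mul_inv_cancel₀ h, one_smul]
  have hfi : Integrable f (gaussN n) := by
    have := (integrable_withDensity_ofReal_iff (E := ℝ) hfm hf (g := fun _ => 1)).1
      (by rw [← hν]; exact integrable_const _)
    simpa using this
  have hxf : Integrable (fun x => ‖x‖ * f x) (gaussN n) := by
    have := (integrable_withDensity_ofReal_iff (E := ℝ) hfm hf (g := fun x => ‖x‖)).1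
      (by rw [← hν]; exact hx.norm)
    simpa [mul_comm] using this
  have hGi : Integrable (weakGradient f) (gaussN n) := by
    have := (integrable_withDensity_ofReal_iff hfm hf (g := gradientLog f)).1
      (by rw [← hν]; exact hL.integrable (by simp))
    exact this.congr hz
  refine ⟨hLi, fun i h hh C hC hC' => ?_⟩
  have hc := hh.continuous
  have hpc := (contDiff_pderivAt hh i).continuous
  have h1 := hw.gaussian_ibp hfi hxf hGi hh hC hC' (EuclideanSpace.single i 1)
  simp only [inner_single_one] at h1
  have i1 : Integrable (fun x => pderivAt i h x) ν :=
    integrable_of_continuous_bounded hpc fun x => (abs_pderivAt_le i h x).trans (hC' x)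
  have i2 : Integrable (fun x : Euc n => x i * h x) ν :=
    (hx.eval_piLp i).mul_bdd (c := C) hc.aestronglyMeasurable (.of_forall hC)
  have e1 : ∫ x, f x * (pderivAt i h x - x i * h x) ∂(gaussN n) =
      ∫ x, pderivAt i h x ∂ν - ∫ x, x i * h x ∂ν := by
    rw [← integral_sub i1 i2, hν, integral_withDensity_ofReal hfm hf]
  have e2 : ∫ x, weakGradient f x i * h x ∂(gaussN n) = ∫ x, h x * gradientLog f x i ∂ν := by
    rw [hν, integral_withDensity_ofReal hfm hf]
    refine integral_congr_ae ?_
    filter_upwards [hz] with x hx0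
    rw [← hx0]
    simp only [PiLp.smul_apply, smul_eq_mul]
    ring
  have e3 : ∫ x, f x * (pderivAt i h x - x i * h x) ∂(gaussN n) =
      -∫ x, weakGradient f x i * h x ∂(gaussN n) := h1
  rw [e1, e2] at e3
  linarith

/-- The score identity with the test function 1. -/
lemma IsScore.integral_eq {S : Fin n → Euc n → ℝ} [IsProbabilityMeasure ν] (hS : IsScore ν S)
    (i : Fin n) : ∫ x, S i x ∂ν = ∫ x, x i ∂ν := by
  have := hS.2 i (fun _ => 1) contDiff_const 1 (by simp) (by simp)
  simpa [pderivAt] using this.symm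

end Score

end

/-! ### The deficit estimate from the entropy bound -/

theorem mainTheorem5 (n : ℕ) (lam : ℝ) (hlam : 0 < lam)
    (f : EuclideanSpace ℝ (Fin n) → ℝ) (hf_meas : Measurable f) (hf_nonneg : ∀ x, 0 ≤ f x)
    (hf_diff : WeaklyDifferentiable f)
    (ν : Measure (EuclideanSpace ℝ (Fin n)))
    (hν : ν = (stdGaussian (EuclideanSpace ℝ (Fin n))).withDensity
      (fun x => ENNReal.ofReal (f x)))
    (hνP : ν ∈ poincareClass n lam)
    (hH : Integrable (fun x => f x * Real.log (f x)) (stdGaussian (EuclideanSpace ℝ (Fin n))))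
    (hI : Integrable (fisherIntegrand f) (stdGaussian (EuclideanSpace ℝ (Fin n)))) :
    Integrable (fun x => x) ν ∧
    Integrable (fun x => ‖gradientLog f x - ∫ y, y ∂ν‖ ^ 2) ν ∧
    deficitLSI f ≥ lsiConstOne lam * ∫ x, ‖gradientLog f x - ∫ y, y ∂ν‖ ^ 2 ∂ν := by
  have hp : IsProbabilityMeasure ν := hνP.1
  have hx := integrable_id_of_poincare hlam hνP
  have hL := memLp_gradientLog hf_meas hf_nonneg hf_diff hν hI
  have hS := isScore_gradientLog hf_meas hf_nonneg hf_diff hν hx hI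
  have hint : Integrable (fun x => ‖gradientLog f x - ∫ y, y ∂ν‖ ^ 2) ν :=
    (memLp_two_iff_integrable_sq_norm (hL.sub (memLp_const _)).1).1 (hL.sub (memLp_const _))
  refine ⟨hx, hint, ?_⟩
  have hb : ∀ i, (∫ y, y ∂ν) i = ∫ y, gradientLog f y i ∂ν := fun i => by
    rw [eval_integral_piLp fun i => hx.eval_piLp i, hS.integral_eq]
  have hνγ : ν ≪ gaussN n := by
    rw [hν]; exact withDensity_absolutelyContinuous _ _
  have hfi : Integrable f (gaussN n) := by
    have := (integrable_withDensity_ofReal_iff (E := ℝ) hf_meas hf_nonneg (g := fun _ => 1)).1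
      (by rw [← hν]; exact integrable_const _)
    simpa using this
  have hf1 : ∫ x, f x ∂(gaussN n) = 1 := by
    have := integral_withDensity_ofReal hf_meas hf_nonneg (fun _ => 1)
    rw [← hν] at this
    simpa using this.symm
  set b : Fin n → ℝ := fun i => ∫ y, gradientLog f y i ∂ν with hbdef
  set A := ∑ i, ∫ x, (gradientLog f x i - b i) ^ 2 ∂ν with hA
  have hent : relativeEntropy f ≤ (1 / 2) * (∑ i, b i ^ 2 + lsiConst lam * A) :=
    integral_mul_log_le_of_dual hf_meas hf_nonneg hfi hf1 hH fun g hg ⟨M, hM⟩ => by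
      have := integral_sub_log_integral_exp_le hlam hνP hνγ hS hg hM
      rw [← integral_withDensity_ofReal hf_meas hf_nonneg, ← hν]
      exact this
  have hAi : ∀ i, Integrable (fun x => (gradientLog f x i - b i) ^ 2) ν := fun i =>
    ((hS.1 i).sub (memLp_const _)).integrable_sq
  have hAeq : ∫ x, ‖gradientLog f x - ∫ y, y ∂ν‖ ^ 2 ∂ν = A := by
    simp_rw [EuclideanSpace.real_norm_sq_eq, PiLp.sub_apply, hb]
    exact integral_finsetSum _ fun i _ => hAi i
  -- Since b is the mean of ∇ log f under ν, its second moment splits into variance plus squared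
  -- mean.
  have hIeq : fisherInformation f = A + ∑ i, b i ^ 2 := by
    have e1 : fisherInformation f = ∫ x, ‖gradientLog f x‖ ^ 2 ∂ν := by
      rw [hν, integral_withDensity_ofReal hf_meas hf_nonneg]
      simp only [mul_norm_gradientLog_sq]
      rfl
    rw [e1, hA, ← Finset.sum_add_distrib]
    simp_rw [EuclideanSpace.real_norm_sq_eq]
    rw [integral_finsetSum _ fun i _ => (hS.1 i).integrable_sq]
    refine Finset.sum_congr rfl fun i _ => ?_
    have hSi : Integrable (fun x => gradientLog f x i) ν := (hS.1 i).integrable (by simp)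
    have e2 : ∀ x, gradientLog f x i ^ 2 = (gradientLog f x i - b i) ^ 2 +
        (2 * b i * gradientLog f x i - b i ^ 2) := fun x => by ring
    have j1 : Integrable (fun x => 2 * b i * gradientLog f x i - b i ^ 2) ν :=
      (hSi.const_mul _).sub (integrable_const _)
    simp_rw [e2]
    rw [integral_add (hAi i) j1, integral_sub (hSi.const_mul _) (integrable_const _),
      integral_const_mul]
    simp only [integral_const, probReal_univ, one_smul]
    change _ + (2 * b i * b i - _) = _
    ring
  rw [hAeq, deficitLSI, hIeq, lsiConstOne]
  linarith
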